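/- Let $R>0$ and let $n\ge 2$ be an integer. The $n$-con is the solid in $\mathbb R^3$ (coordinates $x,y,z$) constructed as follows. (I) Take the solid right circular cone standing on the plane $z=0$, with axis the $z$-axis, radius $R$ and apex angle $\pi-\frac{\pi}{n}$. (II) Cut off and discard two wedges along the two planes that contain the $y$-axis and make angle $\frac{\pi}{2}-\frac{\pi}{n}$ with the horizontal; that is, keep the part where $z\ge |x|\tan(\frac{\pi}{2}-\frac{\pi}{n})$. (III) Glue $n$ copies of this piece along their flat faces around the $y$-axis; that is, take the union of the rotations of the piece about the $y$-axis through $\frac{2\pi k}{n}$, $0\le k<n$. (IV) Cut the result into two halves by the plane $y=0$, rotate one half about the $y$-axis through $\frac{\pi}{n}$, and take the union of the two halves. The $2$-con is the sphericon and the $3$-con is the hexacon. The surface area of the $n$-con, that is, the two-dimensional area (Hausdorff measure) of its boundary, is $$\frac{nR^2}{\cos\left(\frac{\pi}{2n}\right)}\,I_n,\qquad I_n=\int_{-\pi/2}^{\pi/2}\frac{d\theta}{(1+e^{\ast}\cos\theta)^2},\qquad e^{\ast}=\cot\left(\tfrac{\pi}{n}\right)\cot\left(\tfrac{\pi}{2n}\right),$$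 where $I_2=\pi$, $I_3=\frac43$, and, for $n>3$, with $c=\cos\frac{\pi}{n}$ and $q=\cos\left(\frac{\pi}{2n}-\frac{\pi}{3}\right)\cos\left(\frac{\pi}{2n}+\frac{\pi}{3}\right)$, $$I_n=\frac{1-c}{q}\left[\frac{c}{2}-\frac{(1-c)^2}{4\sqrt q}\,\log\left(\frac{1+2\sqrt q}{1-2\sqrt q}\right)\right].$$ In particular, the surface area of the sphericon is $2\sqrt2\,\pi R^2$ and that of the hexacon is $\dfrac{8R^2}{\sqrt3}$. -/

import Mathlib

open Real MeasureTheory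

/-- The solid right circular cone sitting on the horizontal `(x,y)`-plane, with axis the `z`-axis,
radius `R` and apex angle `π - π / n`, so that its sloped surface makes the angle `π / (2 n)` with
the horizontal. The coordinates `x, y, z` are `p 0, p 1, p 2`. -/
def solidCone (n : ℕ) (R : ℝ) : Set (EuclideanSpace ℝ (Fin 3)) :=
  {p | 0 ≤ p 2 ∧ p 2 ≤ (R - √(p 0 ^ 2 + p 1 ^ 2)) * tan (π / (2 * n))}

/-- The piece of the cone that is kept after two wedges have been cut off by the two planes that
meet the `(x,y)`-plane in the `y`-axis and make the angle `π / 2 - π / n` with it. -/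
def conePiece (n : ℕ) (R : ℝ) : Set (EuclideanSpace ℝ (Fin 3)) :=
  {p | p ∈ solidCone n R ∧ |p 0| * tan (π / 2 - π / n) ≤ p 2}

/-- The rotation of space about the `y`-axis through the angle `φ`. -/
noncomputable def rotY (φ : ℝ) (p : EuclideanSpace ℝ (Fin 3)) : EuclideanSpace ℝ (Fin 3) :=
  !₂[cos φ * p 0 + sin φ * p 2, p 1, -sin φ * p 0 + cos φ * p 2]

/-- The spindle: `n` congruent pieces glued together along their flat faces, around the `y`-axis. -/
def spindle (n : ℕ) (R : ℝ) : Set (EuclideanSpace ℝ (Fin 3)) :=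
  ⋃ k : Fin n, rotY (2 * π * (k : ℕ) / n) '' conePiece n R

/-- The `n`-con: the spindle is cut into two halves by the plane `y = 0`, one of the halves is
rotated through `π / n`, and the halves are glued together again. -/
def polycon (n : ℕ) (R : ℝ) : Set (EuclideanSpace ℝ (Fin 3)) :=
  {p | p ∈ spindle n R ∧ 0 ≤ p 1} ∪ rotY (π / n) '' {p | p ∈ spindle n R ∧ p 1 ≤ 0}

/-- The surface area of a solid: the two-dimensional Hausdorff measure, normalised to agree with
Lebesgue measure on planes, of its topological boundary. -/
noncomputable def surfaceArea (S : Set (EuclideanSpace ℝ (Fin 3))) : ENNReal :=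
  μHE[2] (frontier S)

/-- The eccentricity of the projections to the horizontal plane of the edges of the piece. -/
noncomputable def projEccentricity (n : ℕ) : ℝ :=
  cot (π / n) * cot (π / (2 * n))

/-- The integral `I_n` of the volume and surface area formulas. -/
noncomputable def polyconIntegral (n : ℕ) : ℝ :=
  ∫ θ in (-(π / 2))..(π / 2), 1 / (1 + projEccentricity n * cos θ) ^ 2

/-- The product `cos (π/2n - π/3) cos (π/2n + π/3)` in the closed form of `I_n`. -/
noncomputable def cosProd (n : ℕ) : ℝ :=
  cos (π / (2 * n) - π / 3) * cos (π / (2 * n) + π / 3)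

/-! The boundary of the `n`-con consists of `2 * n` congruent half sheets of a cone of slope `α = π
/ (2 * n)`, overlapping in null sets. A cone is developable, so the part of it over a planar region
has area `∫ r / cos α dr dθ`. Each edge of a sheet projects to a conic with focus at the centre, so
a half sheet lies over `r ≤ R / (1 + e |cos θ|)`, `0 ≤ θ ≤ π`. Its area is `R ^ 2 / (2 * cos α)`
times `I_n` (`area_halfSheet`).

Area here is Hausdorff measure, so developability is used metrically: on thin sectors the
development is bi-Lipschitz with constant near 1 (`dist_conePoint_le_mul`); summing over sectors and
letting the constant tend to 1 gives `area_conePoint_image`.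

For the topology, the solid is a sublevel set of a continuous, positively homogeneous gauge, so its
frontier is the level set (`frontier_polycon`). Continuity across `y = 0` holds because the section
of the spindle there is a regular `2n`-gon, invariant under rotation through `π / n`
(`spindleGauge_rotY`). -/

/-! ### Area on a cone through its development -/

/-- The point of the cone of slope `α` over the base circle of radius `R` whose projection to the
horizontal plane has the polar coordinates `p`. -/
noncomputable def conePoint (R α : ℝ) (p : ℝ × ℝ) : EuclideanSpace ℝ (Fin 3) :=
  !₂[p.1 * cos p.2, p.1 * sin p.2, (R - p.1) * tan α]

/-- The development of the cone of slope `α` into the plane. -/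
noncomputable def coneDevelopment (α : ℝ) (p : ℝ × ℝ) : ℂ :=
  ⟨p.1 / cos α * cos (cos α * p.2), p.1 / cos α * sin (cos α * p.2)⟩

lemma dist_conePoint_sq {R α : ℝ} (hα : cos α ≠ 0) (p q : ℝ × ℝ) :
    dist (conePoint R α p) (conePoint R α q) ^ 2 =
      (p.1 / cos α - q.1 / cos α) ^ 2 + 2 * p.1 * q.1 * (1 - cos (p.2 - q.2)) := by
  rw [EuclideanSpace.dist_sq_eq, Fin.sum_univ_three]
  simp only [conePoint, Real.dist_eq, sq_abs, cos_sub]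
  simp only [Matrix.cons_val_zero, Matrix.cons_val_one, Matrix.cons_val]
  rw [tan_eq_sin_div_cos]
  field_simp
  linear_combination (p.1 - q.1) ^ 2 * sin_sq_add_cos_sq α +
    cos α ^ 2 * p.1 ^ 2 * sin_sq_add_cos_sq p.2 + cos α ^ 2 * q.1 ^ 2 * sin_sq_add_cos_sq q.2

lemma dist_coneDevelopment_sq {α : ℝ} (p q : ℝ × ℝ) :
    dist (coneDevelopment α p) (coneDevelopment α q) ^ 2 =
      (p.1 / cos α - q.1 / cos α) ^ 2 +
        2 * (p.1 / cos α) * (q.1 / cos α) * (1 - cos (cos α * (p.2 - q.2))) := by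
  rw [Complex.dist_eq_re_im, sq_sqrt (by positivity), mul_sub (cos α), cos_sub]
  simp only [coneDevelopment]
  linear_combination (p.1 / cos α) ^ 2 * sin_sq_add_cos_sq (cos α * p.2) +
    (q.1 / cos α) ^ 2 * sin_sq_add_cos_sq (cos α * q.2)

lemma one_sub_cos_ge {x δ : ℝ} (hδ : δ ≤ 1) (hx : |x| ≤ δ) :
    (1 - δ) * (x ^ 2 / 2) ≤ 1 - cos x := by
  have h := (abs_le.1 (cos_bound (hx.trans hδ))).2
  have h1 : |x| ^ 4 ≤ δ * x ^ 2 := by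
    have : |x| ^ 2 ≤ δ := by nlinarith [abs_nonneg x]
    calc |x| ^ 4 = |x| ^ 2 * |x| ^ 2 := by ring
      _ ≤ δ * |x| ^ 2 := by gcongr
      _ = _ := by rw [sq_abs]
  nlinarith [abs_nonneg x, sq_nonneg x]

/-- The squared distances share their radial term, and for angle difference `x` both angular terms
are asymptotic to `p.1 * q.1 * x ^ 2`. Their ratio does not involve the radii, so the estimate is
uniform up to the apex. -/
lemma dist_conePoint_le_mul {R α : ℝ} (hα : 0 < cos α) {K : NNReal} (hK : 1 < K) :
    ∃ δ : ℝ, 0 < δ ∧ δ < 1 ∧ ∀ p q : ℝ × ℝ, 0 < p.1 → 0 < q.1 → |p.2 - q.2| ≤ δ →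
      dist (conePoint R α p) (conePoint R α q) ≤
        K * dist (coneDevelopment α p) (coneDevelopment α q) ∧
      dist (coneDevelopment α p) (coneDevelopment α q) ≤
        K * dist (conePoint R α p) (conePoint R α q) := by
  have hK' : (1 : ℝ) < K := by exact_mod_cast hK
  have hK2 : (1 : ℝ) < (K : ℝ) ^ 2 := by nlinarith
  have hKi : ((K : ℝ) ^ 2)⁻¹ < 1 := inv_lt_one_of_one_lt₀ hK2
  have hKp : 0 < ((K : ℝ) ^ 2)⁻¹ := by positivity
  -- With this `δ` the factor `1 - δ` of `one_sub_cos_ge` is exactly `K⁻²`.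
  refine ⟨1 - ((K : ℝ) ^ 2)⁻¹, by linarith, by linarith, fun p q hp hq hpq ↦ ?_⟩
  set x := p.2 - q.2 with hx
  have hu := cos_le_one α
  have hb1 := one_sub_cos_ge (by linarith) hpq
  have hux : |cos α * x| ≤ 1 - ((K : ℝ) ^ 2)⁻¹ := by
    rw [abs_mul, abs_of_pos hα]
    nlinarith [abs_nonneg x]
  have hb2 := one_sub_cos_ge (by linarith) hux
  have hc1 := one_sub_sq_div_two_le_cos (x := x)
  have hc2 := one_sub_sq_div_two_le_cos (x := cos α * x)
  rw [sub_sub_cancel] at hb1 hb2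
  have e1 : x ^ 2 / 2 ≤ (K : ℝ) ^ 2 * (1 - cos x) := by
    rwa [inv_mul_le_iff₀ (by positivity)] at hb1
  have e2 : (cos α * x) ^ 2 / 2 ≤ (K : ℝ) ^ 2 * (1 - cos (cos α * x)) := by
    rwa [inv_mul_le_iff₀ (by positivity)] at hb2
  have hpq' : 0 < p.1 / cos α * (q.1 / cos α) := by positivity
  have hpq'' : p.1 * q.1 = p.1 / cos α * (q.1 / cos α) * cos α ^ 2 := by field_simp
  have hs := mul_nonneg (sub_nonneg.2 hK2.le) (sq_nonneg (p.1 / cos α - q.1 / cos α))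
  constructor
  · refine le_of_sq_le_sq ?_ (by positivity)
    rw [mul_pow, dist_conePoint_sq hα.ne', dist_coneDevelopment_sq, ← hx]
    have : cos α ^ 2 * (1 - cos x) ≤ (K : ℝ) ^ 2 * (1 - cos (cos α * x)) := by
      nlinarith [sq_nonneg (cos α)]
    have := mul_le_mul_of_nonneg_left this hpq'.le
    linear_combination hs + 2 * this + 2 * (1 - cos x) * hpq''
  · refine le_of_sq_le_sq ?_ (by positivity)
    rw [mul_pow, dist_conePoint_sq hα.ne', dist_coneDevelopment_sq, ← hx]
    have : 1 - cos (cos α * x) ≤ (K : ℝ) ^ 2 * (cos α ^ 2 * (1 - cos x)) := by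
      nlinarith [sq_nonneg (cos α)]
    have := mul_le_mul_of_nonneg_left this hpq'.le
    linear_combination hs + 2 * this - 2 * K ^ 2 * (1 - cos x) * hpq''

/-- The inequality makes `f` constant on the fibres of `g` in `s`, so `f ∘ g⁻¹` is a well-defined
`K`-Lipschitz map from `g '' s` onto `f '' s`. -/
lemma euclideanHausdorffMeasure_image_le_mul {ι X Y : Type*} [MetricSpace X]
    [MeasurableSpace X] [BorelSpace X] [MetricSpace Y] [MeasurableSpace Y]
    [BorelSpace Y] {f : ι → X} {g : ι → Y} {s : Set ι} {K : NNReal} (d : ℕ)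
    (h : ∀ a ∈ s, ∀ b ∈ s, dist (f a) (f b) ≤ K * dist (g a) (g b)) :
    μHE[d] (f '' s) ≤ (K : ENNReal) ^ d * μHE[d] (g '' s) := by
  rcases s.eq_empty_or_nonempty with rfl | ⟨a₀, -⟩
  · simp
  have : Nonempty ι := ⟨a₀⟩
  have hinv : ∀ y ∈ g '' s, ∃ a ∈ s, g a = y := fun y hy ↦ hy
  choose! i hi hgi using hinv
  have hfi : ∀ a ∈ s, f (i (g a)) = f a := fun a ha ↦ by
    have := h _ (hi _ ⟨a, ha, rfl⟩) a ha
    rw [hgi _ ⟨a, ha, rfl⟩, dist_self, mul_zero] at this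
    exact dist_le_zero.1 this
  have hL : LipschitzOnWith K (f ∘ i) (g '' s) := by
    refine LipschitzOnWith.of_dist_le_mul fun x hx y hy ↦ ?_
    have := h _ (hi x hx) _ (hi y hy)
    rwa [hgi x hx, hgi y hy] at this
  have himg : (f ∘ i) '' (g '' s) = f '' s := by
    rw [Set.image_image]
    exact Set.image_congr hfi
  have := hL.hausdorffMeasure_image_le (d := d) (by positivity)
  rw [himg] at this
  simp only [Measure.euclideanHausdorffMeasure_def, Measure.smul_apply]
  refine (smul_le_smul_of_nonneg_left this zero_le).trans_eq ?_
  simp only [ENNReal.rpow_natCast, ENNReal.smul_def, smul_eq_mul]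
  ring

lemma injOn_coneDevelopment {α : ℝ} (hα : 0 < cos α) {B : Set (ℝ × ℝ)}
    (hB : ∀ p ∈ B, 0 < p.1) (h1 : ∀ p ∈ B, ∀ q ∈ B, |p.2 - q.2| < 1) :
    Set.InjOn (coneDevelopment α) B := by
  intro p hp q hq hpq
  have h := dist_coneDevelopment_sq (α := α) p q
  have hp0 := hB p hp
  have hq0 := hB q hq
  have hd := h1 p hp q hq
  rw [hpq, dist_self] at h
  have hc : 0 ≤ 1 - cos (cos α * (p.2 - q.2)) := sub_nonneg.2 (cos_le_one _)
  have hpos : 0 < 2 * (p.1 / cos α) * (q.1 / cos α) := by positivity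
  have h2 : 1 - cos (cos α * (p.2 - q.2)) = 0 := by
    have := mul_nonneg hpos.le hc
    have h3 : 2 * (p.1 / cos α) * (q.1 / cos α) * (1 - cos (cos α * (p.2 - q.2))) = 0 := by
      nlinarith [sq_nonneg (p.1 / cos α - q.1 / cos α)]
    exact (mul_eq_zero.1 h3).resolve_left hpos.ne'
  rw [h2] at h
  have h4 : p.1 / cos α - q.1 / cos α = 0 := by
    rw [← sq_eq_zero_iff]
    linarith
  have h5 : |cos α * (p.2 - q.2)| ≤ |p.2 - q.2| := by
    rw [abs_mul, abs_of_pos hα]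
    exact mul_le_of_le_one_left (abs_nonneg _) (cos_le_one α)
  have h6 := one_sub_cos_ge hd.le h5
  rw [h2] at h6
  have h7 : cos α * (p.2 - q.2) = 0 := by
    by_contra hne
    have : 0 < (cos α * (p.2 - q.2)) ^ 2 := by positivity
    nlinarith
  have h8 := (mul_eq_zero.1 h7).resolve_left hα.ne'
  rw [sub_eq_zero, div_left_inj' hα.ne'] at h4
  exact Prod.ext h4 (sub_eq_zero.1 h8)

/-- The development is the polar coordinate map after the linear map `diag ((cos α)⁻¹, cos α)` of
determinant 1, so its Jacobian is the new radius `r / cos α`. -/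
lemma volume_coneDevelopment_image {α : ℝ} (hα : 0 < cos α) {B : Set (ℝ × ℝ)}
    (hBm : MeasurableSet B) (hB : ∀ p ∈ B, 0 < p.1)
    (h1 : ∀ p ∈ B, ∀ q ∈ B, |p.2 - q.2| < 1) :
    volume (coneDevelopment α '' B) = ∫⁻ p in B, ENNReal.ofReal (p.1 / cos α) := by
  let L : ℝ × ℝ →L[ℝ] ℝ × ℝ := ((cos α)⁻¹ • ContinuousLinearMap.id ℝ ℝ).prodMap
    ((cos α) • ContinuousLinearMap.id ℝ ℝ)
  have hL : ∀ p, L p = ((cos α)⁻¹ * p.1, cos α * p.2) := fun p ↦ rfl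
  have hdet : L.det = 1 := by
    have : (L : ℝ × ℝ →ₗ[ℝ] ℝ × ℝ) = LinearMap.prodMap ((cos α)⁻¹ • LinearMap.id)
      ((cos α) • LinearMap.id) := rfl
    rw [ContinuousLinearMap.det, this, LinearMap.det_prodMap]
    simp [hα.ne']
  have hcomp : ∀ p, coneDevelopment α p =
      Complex.measurableEquivRealProd.symm (polarCoord.symm (L p)) := fun p ↦ by
    rw [hL]
    apply Complex.ext <;>
      simp [coneDevelopment, Complex.measurableEquivRealProd, div_eq_inv_mul]
  have himg : coneDevelopment α '' B = Complex.measurableEquivRealProd.symm ''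
      ((fun p ↦ polarCoord.symm (L p)) '' B) := by
    rw [Set.image_image]
    exact Set.image_congr fun p _ ↦ hcomp p
  have hder : ∀ p ∈ B, HasFDerivWithinAt (fun p ↦ polarCoord.symm (L p))
      ((fderivPolarCoordSymm (L p)).comp L) B p := fun p _ ↦
    ((hasFDerivAt_polarCoord_symm (L p)).comp p L.hasFDerivAt).hasFDerivWithinAt
  have hinj : Set.InjOn (fun p ↦ polarCoord.symm (L p)) B := fun p hp q hq hpq ↦ by
    refine injOn_coneDevelopment hα hB h1 hp hq ?_
    rw [hcomp, hcomp]
    exact congrArg _ hpq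
  rw [himg, MeasurableEquiv.image_symm, Complex.volume_preserving_equiv_real_prod.measure_preimage_equiv,
    ← lintegral_abs_det_fderiv_eq_addHaar_image volume hBm hder hinj]
  refine setLIntegral_congr_fun hBm fun p hp ↦ ?_
  have hdc : ((fderivPolarCoordSymm (L p)).comp L).det = p.1 / cos α := by
    have : ((fderivPolarCoordSymm (L p)).comp L).det =
        (fderivPolarCoordSymm (L p)).det * L.det := LinearMap.det_comp _ _
    rw [this, hdet, det_fderivPolarCoordSymm, hL, mul_one, div_eq_inv_mul]
  have := hB p hp
  simp only [hdc]
  rw [abs_of_pos (by positivity)]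

lemma continuous_conePoint (R α : ℝ) : Continuous (conePoint R α) := by
  unfold conePoint
  fun_prop

/-- Cut `B` into countably many sectors of angle at most `δ` and compare each with its development.
The upper bound needs only subadditivity; the lower bound needs the images to be disjoint and
measurable, hence injectivity. -/
lemma conePoint_image_sector {R α : ℝ} (hα : 0 < cos α) {B : Set (ℝ × ℝ)}
    (hBm : MeasurableSet B) (hB : ∀ p ∈ B, 0 < p.1) {K : NNReal} (hK : 1 < K) :
    μHE[2] (conePoint R α '' B) ≤
        (K : ENNReal) ^ 2 * ∫⁻ p in B, ENNReal.ofReal (p.1 / cos α) ∧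
      (Set.InjOn (conePoint R α) B → ∫⁻ p in B, ENNReal.ofReal (p.1 / cos α) ≤
        (K : ENNReal) ^ 2 * μHE[2] (conePoint R α '' B)) := by
  obtain ⟨δ, hδ, hδ1, hd⟩ := dist_conePoint_le_mul (R := R) hα hK
  let C : ℤ → Set (ℝ × ℝ) := fun j ↦ B ∩ {p | ⌊p.2 / δ⌋ = j}
  have hCm : ∀ j, MeasurableSet (C j) := fun j ↦
    hBm.inter (measurableSet_eq_fun (by fun_prop) measurable_const)
  have hCd : Pairwise (Function.onFun Disjoint C) := fun i j hij ↦
    Set.disjoint_left.2 fun p hp hq ↦ hij (hp.2.symm.trans hq.2)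
  have hCB : ∀ j, ∀ p ∈ C j, 0 < p.1 := fun j p hp ↦ hB p hp.1
  have hCδ : ∀ j, ∀ p ∈ C j, ∀ q ∈ C j, |p.2 - q.2| ≤ δ := fun j p hp q hq ↦ by
    have := Int.abs_sub_lt_one_of_floor_eq_floor (hp.2.trans hq.2.symm)
    rw [← sub_div, abs_div, abs_of_pos hδ, div_lt_one hδ] at this
    exact this.le
  have hCU : B = ⋃ j, C j := by
    ext p
    simp [C]
  have hvol : ∀ j, μHE[2] (coneDevelopment α '' C j) =
      ∫⁻ p in C j, ENNReal.ofReal (p.1 / cos α) := fun j ↦ by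
    rw [← volume_coneDevelopment_image hα (hCm j) (hCB j)
      fun p hp q hq ↦ (hCδ j p hp q hq).trans_lt hδ1]
    have := InnerProductSpace.euclideanHausdorffMeasure_eq_volume (V := ℂ)
    rw [Complex.finrank_real_complex] at this
    rw [this]
  have hsum : ∫⁻ p in B, ENNReal.ofReal (p.1 / cos α) =
      ∑' j, ∫⁻ p in C j, ENNReal.ofReal (p.1 / cos α) := by
    conv_lhs => rw [hCU]
    exact lintegral_iUnion hCm hCd _
  rw [hsum, ← ENNReal.tsum_mul_left]
  constructor
  · conv_lhs => rw [hCU, Set.image_iUnion]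
    refine (measure_iUnion_le _).trans (ENNReal.tsum_le_tsum fun j ↦ ?_)
    rw [← hvol]
    exact euclideanHausdorffMeasure_image_le_mul 2 fun p hp q hq ↦
      (hd p q (hCB j p hp) (hCB j q hq) (hCδ j p hp q hq)).1
  · intro hinj
    have : μHE[2] (conePoint R α '' B) = ∑' j, μHE[2] (conePoint R α '' C j) := by
      conv_lhs => rw [hCU, Set.image_iUnion]
      refine measure_iUnion (fun i j hij ↦ ?_) fun j ↦
        (hCm j).image_of_continuousOn_injOn (continuous_conePoint R α).continuousOn
          (hinj.mono Set.inter_subset_left)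
      refine Set.disjoint_left.2 ?_
      rintro _ ⟨p, hp, rfl⟩ ⟨q, hq, hqp⟩
      exact Set.disjoint_left.1 (hCd hij) hp (hinj hq.1 hp.1 hqp ▸ hq)
    rw [this, ← ENNReal.tsum_mul_left]
    refine ENNReal.tsum_le_tsum fun j ↦ ?_
    rw [← hvol]
    exact euclideanHausdorffMeasure_image_le_mul 2 fun p hp q hq ↦
      (hd p q (hCB j p hp) (hCB j q hq) (hCδ j p hp q hq)).2

lemma ENNReal.le_of_forall_one_lt_le_sq_mul {a b : ENNReal}
    (h : ∀ K : NNReal, 1 < K → a ≤ (K : ENNReal) ^ 2 * b) : a ≤ b := by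
  have h1 : Filter.Tendsto (fun K : NNReal ↦ ((K ^ 2 : NNReal) : ENNReal) * b)
      (nhdsWithin 1 (Set.Ioi 1)) (nhds (((1 ^ 2 : NNReal) : ENNReal) * b)) := by
    refine ENNReal.Tendsto.mul_const ?_ (Or.inl (by simp))
    refine ENNReal.tendsto_coe.2 ?_
    exact ((continuous_pow 2).tendsto 1).mono_left nhdsWithin_le_nhds
  simp only [one_pow, ENNReal.coe_one, one_mul, ENNReal.coe_pow] at h1
  exact ge_of_tendsto h1 (Filter.eventually_of_mem self_mem_nhdsWithin fun K hK ↦ h K hK)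

lemma area_conePoint_image_le {R α : ℝ} (hα : 0 < cos α) {B : Set (ℝ × ℝ)}
    (hBm : MeasurableSet B) (hB : ∀ p ∈ B, 0 < p.1) :
    μHE[2] (conePoint R α '' B) ≤ ∫⁻ p in B, ENNReal.ofReal (p.1 / cos α) :=
  ENNReal.le_of_forall_one_lt_le_sq_mul fun _ hK ↦ (conePoint_image_sector hα hBm hB hK).1

lemma area_conePoint_image {R α : ℝ} (hα : 0 < cos α) {B : Set (ℝ × ℝ)}
    (hBm : MeasurableSet B) (hB : ∀ p ∈ B, 0 < p.1) (hinj : Set.InjOn (conePoint R α) B) :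
    μHE[2] (conePoint R α '' B) = ∫⁻ p in B, ENNReal.ofReal (p.1 / cos α) :=
  (area_conePoint_image_le hα hBm hB).antisymm <|
    ENNReal.le_of_forall_one_lt_le_sq_mul fun _ hK ↦ (conePoint_image_sector hα hBm hB hK).2 hinj

/-! ### The half sheet in polar coordinates -/

/-- The half on which `0 ≤ y` of the curved face of the piece of the cone of slope `α`. -/
def halfSheet (R α : ℝ) : Set (EuclideanSpace ℝ (Fin 3)) :=
  {p | p 2 = (R - √(p 0 ^ 2 + p 1 ^ 2)) * tan α ∧ |p 0| * cos (2 * α) ≤ p 2 * sin (2 * α) ∧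
    0 ≤ p 1}

/-- The polar coordinates of the projection of `halfSheet`, where `e` is the eccentricity of the
projections of its edges. -/
def halfSheetPolar (R e : ℝ) : Set (ℝ × ℝ) :=
  {p | 0 < p.1 ∧ p.2 ∈ Set.Icc 0 π ∧ p.1 * (1 + e * |cos p.2|) ≤ R}

lemma isClosed_halfSheet (R α : ℝ) : IsClosed (halfSheet R α) := by
  simp only [halfSheet, Set.ofPred_and]
  exact (isClosed_eq (by fun_prop) (by fun_prop)).inter
    ((isClosed_le (by fun_prop) (by fun_prop)).inter (isClosed_le (by fun_prop) (by fun_prop)))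

lemma measurableSet_halfSheetPolar (R e : ℝ) : MeasurableSet (halfSheetPolar R e) := by
  simp only [halfSheetPolar, Set.ofPred_and]
  exact (measurableSet_lt measurable_const measurable_fst).inter
    ((measurable_snd measurableSet_Icc).inter (measurableSet_le (by fun_prop) measurable_const))

lemma sqrt_conePoint {R α : ℝ} {p : ℝ × ℝ} (hp : 0 < p.1) :
    √(conePoint R α p 0 ^ 2 + conePoint R α p 1 ^ 2) = p.1 := by
  have : conePoint R α p 0 ^ 2 + conePoint R α p 1 ^ 2 = p.1 ^ 2 := by
    simp only [conePoint, Matrix.cons_val_zero, Matrix.cons_val_one]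
    linear_combination p.1 ^ 2 * sin_sq_add_cos_sq p.2
  rw [this, sqrt_sq hp.le]

lemma exists_conePoint_eq {R α : ℝ} {p : EuclideanSpace ℝ (Fin 3)}
    (hp : p 2 = (R - √(p 0 ^ 2 + p 1 ^ 2)) * tan α) (hp1 : 0 ≤ p 1)
    (hne : p ≠ conePoint R α (0, 0)) :
    ∃ q : ℝ × ℝ, 0 < q.1 ∧ q.2 ∈ Set.Icc 0 π ∧ conePoint R α q = p := by
  set r := √(p 0 ^ 2 + p 1 ^ 2) with hr
  have hr2 : r ^ 2 = p 0 ^ 2 + p 1 ^ 2 := sq_sqrt (by positivity)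
  have hr0 : 0 < r := by
    refine lt_of_le_of_ne (sqrt_nonneg _) fun h0 ↦ hne ?_
    rw [← h0] at hr2 hp
    have h00 : p 0 = 0 := by nlinarith [sq_nonneg (p 0), sq_nonneg (p 1)]
    have h01 : p 1 = 0 := by nlinarith [sq_nonneg (p 0), sq_nonneg (p 1)]
    ext i
    fin_cases i <;> simp [conePoint, h00, h01, hp]
  have hle : |p 0 / r| ≤ 1 := by
    rw [abs_div, abs_of_pos hr0, div_le_one hr0]
    exact abs_le_of_sq_le_sq (by nlinarith [sq_nonneg (p 1)]) hr0.le
  have hs : r * sin (arccos (p 0 / r)) = p 1 := by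
    rw [sin_arccos]
    have : 1 - (p 0 / r) ^ 2 = (p 1 / r) ^ 2 := by
      field_simp
      linarith
    rw [this, sqrt_sq (by positivity)]
    field_simp
  refine ⟨(r, arccos (p 0 / r)), hr0, ⟨arccos_nonneg _, arccos_le_pi _⟩, ?_⟩
  have hc : r * cos (arccos (p 0 / r)) = p 0 := by
    rw [cos_arccos (abs_le.1 hle).1 (abs_le.1 hle).2]
    field_simp
  ext i
  fin_cases i <;> simp [conePoint, hs, hc, hp]

/-- The condition that bounds the piece of the cone, in polar coordinates. -/
lemma conePoint_wedge {R α e : ℝ} (hα : 0 < cos α) (he : e * (sin α * sin (2 * α)) =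
    cos α * cos (2 * α)) {p : ℝ × ℝ} (hp : 0 < p.1) :
    conePoint R α p 2 * sin (2 * α) - |conePoint R α p 0| * cos (2 * α) =
      tan α * sin (2 * α) * (R - p.1 * (1 + e * |cos p.2|)) := by
  have he' : e * (tan α * sin (2 * α)) = cos (2 * α) := by
    rw [tan_eq_sin_div_cos]
    field_simp
    linarith
  simp only [conePoint, Matrix.cons_val_zero, Matrix.cons_val]
  rw [abs_mul, abs_of_pos hp, ← he']
  ring

/-- The radius is the distance from the axis, and the cosine determines an angle in `[0, π]`. -/
lemma injOn_conePoint (R α e : ℝ) : Set.InjOn (conePoint R α) (halfSheetPolar R e) := by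
  intro p hp q hq hpq
  have h1 := sqrt_conePoint (R := R) (α := α) hp.1
  rw [hpq, sqrt_conePoint hq.1] at h1
  have h2 : conePoint R α p 0 = conePoint R α q 0 := by rw [hpq]
  simp only [conePoint, Matrix.cons_val_zero] at h2
  rw [h1] at h2
  exact Prod.ext h1.symm (injOn_cos hp.2.1 hq.2.1 (mul_left_cancel₀ hp.1.ne' h2))

lemma conePoint_image_subset {R α e : ℝ} (hα : 0 < cos α) (hs : 0 < tan α * sin (2 * α))
    (he : e * (sin α * sin (2 * α)) = cos α * cos (2 * α)) :
    conePoint R α '' halfSheetPolar R e ⊆ halfSheet R α := by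
  rintro _ ⟨p, hp, rfl⟩
  refine ⟨?_, ?_, ?_⟩
  · rw [sqrt_conePoint hp.1]
    simp [conePoint]
  · have := conePoint_wedge (R := R) hα he hp.1
    have h2 := mul_nonneg hs.le (sub_nonneg.2 hp.2.2)
    linarith
  · simp only [conePoint, Matrix.cons_val_one, Matrix.cons_val_zero]
    exact mul_nonneg hp.1.le (sin_nonneg_of_mem_Icc hp.2.1)

lemma exists_mem_halfSheetPolar {R α e : ℝ} (hα : 0 < cos α) (hs : 0 < tan α * sin (2 * α))
    (he : e * (sin α * sin (2 * α)) = cos α * cos (2 * α)) {p : EuclideanSpace ℝ (Fin 3)}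
    (hp : p ∈ halfSheet R α) (hne : p ≠ conePoint R α (0, 0)) :
    ∃ q ∈ halfSheetPolar R e, conePoint R α q = p := by
  obtain ⟨q, hq, hq', rfl⟩ := exists_conePoint_eq hp.1 hp.2.2 hne
  refine ⟨q, ⟨hq, hq', ?_⟩, rfl⟩
  have h1 := conePoint_wedge (R := R) hα he hq
  have h2 := hp.2.1
  have h3 : 0 ≤ tan α * sin (2 * α) * (R - q.1 * (1 + e * |cos q.2|)) := by linarith
  linarith [nonneg_of_mul_nonneg_right h3 hs]

lemma euclideanHausdorffMeasure_singleton {X : Type*} [MetricSpace X] [MeasurableSpace X]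
    [BorelSpace X] (x : X) {d : ℕ} (hd : 0 < d) : μHE[d] ({x} : Set X) = 0 := by
  have := Measure.nullSingletonClass_hausdorff X (d := (d : ℝ)) (by exact_mod_cast hd)
  rw [Measure.euclideanHausdorffMeasure_def, Measure.smul_apply, measure_singleton, smul_zero]

/-- Polar coordinates with `0 < r` miss only the apex `conePoint R α (0, 0)`, a null set. -/
lemma area_halfSheet_eq_lintegral {R α e : ℝ} (hα : 0 < cos α) (hs : 0 < tan α * sin (2 * α))
    (he : e * (sin α * sin (2 * α)) = cos α * cos (2 * α)) :
    μHE[2] (halfSheet R α) = ∫⁻ p in halfSheetPolar R e, ENNReal.ofReal (p.1 / cos α) := by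
  rw [← area_conePoint_image hα (measurableSet_halfSheetPolar R e) (fun p hp ↦ hp.1)
    (injOn_conePoint R α e)]
  refine le_antisymm ?_ (measure_mono (conePoint_image_subset hα hs he))
  have : halfSheet R α ⊆ {conePoint R α (0, 0)} ∪ conePoint R α '' halfSheetPolar R e := by
    intro p hp
    by_cases hne : p = conePoint R α (0, 0)
    · exact Or.inl hne
    · exact Or.inr (exists_mem_halfSheetPolar hα hs he hp hne)
  refine (measure_mono this).trans ((measure_union_le _ _).trans ?_)
  rw [euclideanHausdorffMeasure_singleton _ two_pos, zero_add]

lemma area_conePoint_image_eq_zero {R α : ℝ} (hα : 0 < cos α) {B : Set (ℝ × ℝ)}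
    (hBm : MeasurableSet B) (hB : ∀ p ∈ B, 0 < p.1) (h0 : volume B = 0) :
    μHE[2] (conePoint R α '' B) = 0 :=
  le_antisymm ((area_conePoint_image_le hα hBm hB).trans_eq (setLIntegral_measure_zero _ _ h0))
    zero_le

/-- This set contains the overlap of the two halves of the `n`-con, up to rotation; in polar
coordinates it lies on two rays. -/
lemma area_halfSheet_inter_y_eq_zero {R α e : ℝ} (hα : 0 < cos α)
    (hs : 0 < tan α * sin (2 * α))
    (he : e * (sin α * sin (2 * α)) = cos α * cos (2 * α)) :
    μHE[2] (halfSheet R α ∩ {p | p 1 = 0}) = 0 := by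
  let B : Set (ℝ × ℝ) := Set.Ioi 0 ×ˢ {0, π}
  have hsub : halfSheet R α ∩ {p | p 1 = 0} ⊆ {conePoint R α (0, 0)} ∪ conePoint R α '' B := by
    rintro p ⟨hp, hp0⟩
    by_cases hne : p = conePoint R α (0, 0)
    · exact Or.inl hne
    obtain ⟨q, hq, rfl⟩ := exists_mem_halfSheetPolar hα hs he hp hne
    refine Or.inr ⟨q, ⟨hq.1, ?_⟩, rfl⟩
    simp only [conePoint, Set.mem_ofPred_eq, Matrix.cons_val_one, Matrix.cons_val_zero] at hp0
    have h0 := (mul_eq_zero.1 hp0).resolve_left hq.1.ne'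
    by_contra hcon
    simp only [Set.mem_insert_iff, Set.mem_singleton_iff, not_or] at hcon
    exact (sin_pos_of_pos_of_lt_pi (lt_of_le_of_ne hq.2.1.1 (Ne.symm hcon.1))
      (lt_of_le_of_ne hq.2.1.2 hcon.2)).ne' h0
  refine measure_mono_null hsub (measure_union_null
    (euclideanHausdorffMeasure_singleton _ two_pos)
    (area_conePoint_image_eq_zero hα ?_ (fun p hp ↦ hp.1) ?_))
  · exact measurableSet_Ioi.prod (Set.toFinite _).measurableSet
  · have : volume ({0, π} : Set ℝ) = 0 := (Set.toFinite _).measure_zero _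
    rw [Measure.volume_eq_prod, Measure.prod_prod, this, mul_zero]

/-- Neighbouring sheets meet along these edges. In polar coordinates each `θ` leaves the single
radius `R / (1 + e |cos θ|)`, so Fubini gives measure zero. -/
lemma area_halfSheet_inter_edge_eq_zero {R α e : ℝ} (hα : 0 < cos α)
    (hs : 0 < tan α * sin (2 * α)) (he0 : 0 ≤ e)
    (he : e * (sin α * sin (2 * α)) = cos α * cos (2 * α)) :
    μHE[2] (halfSheet R α ∩ {p | p 2 * sin (2 * α) ≤ |p 0| * cos (2 * α)}) = 0 := by
  let B : Set (ℝ × ℝ) := {p | 0 < p.1 ∧ p.1 * (1 + e * |cos p.2|) = R}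
  have hBm : MeasurableSet B := (measurableSet_lt measurable_const measurable_fst).inter
    (measurableSet_eq_fun (by fun_prop) measurable_const)
  have hsub : halfSheet R α ∩ {p | p 2 * sin (2 * α) ≤ |p 0| * cos (2 * α)} ⊆
      {conePoint R α (0, 0)} ∪ conePoint R α '' B := by
    rintro p ⟨hp, hp0⟩
    by_cases hne : p = conePoint R α (0, 0)
    · exact Or.inl hne
    obtain ⟨q, hq, rfl⟩ := exists_mem_halfSheetPolar hα hs he hp hne
    refine Or.inr ⟨q, ⟨hq.1, hq.2.2.antisymm ?_⟩, rfl⟩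
    have h1 := conePoint_wedge (R := R) hα he hq.1
    have h2 : 0 ≤ tan α * sin (2 * α) * (q.1 * (1 + e * |cos q.2|) - R) := by
      have : conePoint R α q 2 * sin (2 * α) ≤ |conePoint R α q 0| * cos (2 * α) := hp0
      linarith
    linarith [nonneg_of_mul_nonneg_right h2 hs]
  refine measure_mono_null hsub (measure_union_null
    (euclideanHausdorffMeasure_singleton _ two_pos)
    (area_conePoint_image_eq_zero hα hBm (fun p hp ↦ hp.1) ?_))
  rw [Measure.volume_eq_prod, Measure.prod_apply_symm hBm]
  refine lintegral_eq_zero_of_ae_eq_zero (Filter.Eventually.of_forall fun θ ↦ ?_)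
  refine measure_mono_null (t := {R / (1 + e * |cos θ|)}) ?_ (measure_singleton _)
  intro r hr
  have : 0 < 1 + e * |cos θ| := by positivity
  exact (eq_div_iff this.ne').2 hr.2

lemma lintegral_halfSheetPolar {R e u : ℝ} (hR : 0 < R) (he : 0 ≤ e) (hu : 0 < u) :
    ∫⁻ p in halfSheetPolar R e, ENNReal.ofReal (p.1 / u) =
      ENNReal.ofReal (R ^ 2 / (2 * u) * ∫ θ in (0 : ℝ)..π, 1 / (1 + e * |cos θ|) ^ 2) := by
  have hpos : ∀ θ, 0 < 1 + e * |cos θ| := fun θ ↦ by positivity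
  have hinner : ∀ θ, ∫⁻ r in Set.Ioc 0 (R / (1 + e * |cos θ|)), ENNReal.ofReal (r / u) =
      ENNReal.ofReal (R ^ 2 / (2 * u) * (1 / (1 + e * |cos θ|) ^ 2)) := fun θ ↦ by
    have hρ : 0 ≤ R / (1 + e * |cos θ|) := (div_pos hR (hpos θ)).le
    rw [← ofReal_integral_eq_lintegral_ofReal, ← intervalIntegral.integral_of_le hρ,
      intervalIntegral.integral_div, integral_id]
    · congr 1
      have := (hpos θ).ne'
      field_simp
      simp
    · exact (Continuous.intervalIntegrable (by fun_prop) _ _).1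
    · refine (ae_restrict_iff' measurableSet_Ioc).2 (Filter.Eventually.of_forall fun r hr ↦ ?_)
      exact div_nonneg hr.1.le hu.le
  have hcont : Continuous fun θ ↦ R ^ 2 / (2 * u) * (1 / (1 + e * |cos θ|) ^ 2) :=
    continuous_const.mul (continuous_const.div (by fun_prop) fun θ ↦ (pow_pos (hpos θ) 2).ne')
  rw [← lintegral_indicator (measurableSet_halfSheetPolar R e), Measure.volume_eq_prod,
    lintegral_prod_symm _ ((Measurable.indicator (by fun_prop)
      (measurableSet_halfSheetPolar R e)).aemeasurable), ← intervalIntegral.integral_const_mul,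
    intervalIntegral.integral_of_le pi_pos.le, ofReal_integral_eq_lintegral_ofReal
      (hcont.intervalIntegrable _ _).1 (Filter.Eventually.of_forall fun θ ↦ by
        have := hpos θ
        simp only [Pi.zero_apply]
        positivity), ← Measure.restrict_congr_set Ioc_ae_eq_Icc.symm, ← lintegral_indicator measurableSet_Icc]
  refine lintegral_congr fun θ ↦ ?_
  by_cases hθ : θ ∈ Set.Icc 0 π
  · rw [Set.indicator_of_mem hθ, ← hinner, ← lintegral_indicator measurableSet_Ioc]
    refine lintegral_congr fun r ↦ ?_
    simp only [Set.indicator, halfSheetPolar, Set.mem_ofPred_eq, Set.mem_Ioc,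
      le_div_iff₀ (hpos θ), hθ, true_and]
  · rw [Set.indicator_of_notMem hθ]
    refine (lintegral_congr fun r ↦ ?_).trans lintegral_zero
    exact Set.indicator_of_notMem (fun h ↦ hθ h.2.1) _

/-- `|cos|` has period `π`, so the interval may be shifted to one where `cos` is nonnegative. -/
lemma integral_comp_abs_cos {f : ℝ → ℝ} (hf : ContinuousOn f (Set.Ici 0)) :
    ∫ θ in (0 : ℝ)..π, f |cos θ| = ∫ θ in (-(π / 2))..(π / 2), f (cos θ) := by
  have hc : Continuous fun θ ↦ f |cos θ| := hf.comp_continuous (by fun_prop) fun θ ↦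
    Set.mem_Ici.2 (abs_nonneg _)
  have h1 : ∫ θ in (-(π / 2))..(π / 2), f (cos θ) = ∫ θ in (-(π / 2))..(π / 2), f |cos θ| := by
    refine intervalIntegral.integral_congr fun θ hθ ↦ ?_
    rw [Set.uIcc_of_le (by linarith [pi_pos])] at hθ
    simp only [abs_of_nonneg (cos_nonneg_of_mem_Icc hθ)]
  have hp : Function.Periodic (fun θ ↦ f |cos θ|) π := fun θ ↦ by simp [cos_add_pi]
  have := hp.intervalIntegral_add_eq 0 (-(π / 2))
  rw [zero_add, show -(π / 2) + π = π / 2 by ring] at this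
  rw [h1, this]

lemma area_halfSheet {R α e : ℝ} (hR : 0 < R) (hα : 0 < cos α) (hs : 0 < tan α * sin (2 * α))
    (he0 : 0 ≤ e) (he : e * (sin α * sin (2 * α)) = cos α * cos (2 * α)) :
    μHE[2] (halfSheet R α) = ENNReal.ofReal
      (R ^ 2 / (2 * cos α) * ∫ θ in (-(π / 2))..(π / 2), 1 / (1 + e * cos θ) ^ 2) := by
  rw [area_halfSheet_eq_lintegral hα hs he, lintegral_halfSheetPolar hR he0 hα,
    integral_comp_abs_cos (f := fun x ↦ 1 / (1 + e * x) ^ 2)]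
  refine continuousOn_const.div (by fun_prop) fun x hx ↦ ?_
  have : 0 < 1 + e * x := by nlinarith [Set.mem_Ici.1 hx]
  positivity

/-! ### Rotations about the `y`-axis -/

@[simp] lemma rotY_apply_zero (φ : ℝ) (p : EuclideanSpace ℝ (Fin 3)) :
    rotY φ p 0 = cos φ * p 0 + sin φ * p 2 := rfl

@[simp] lemma rotY_apply_one (φ : ℝ) (p : EuclideanSpace ℝ (Fin 3)) : rotY φ p 1 = p 1 := rfl

@[simp] lemma rotY_apply_two (φ : ℝ) (p : EuclideanSpace ℝ (Fin 3)) :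
    rotY φ p 2 = -sin φ * p 0 + cos φ * p 2 := rfl

lemma euclideanSpace_ext_three {p q : EuclideanSpace ℝ (Fin 3)} (h0 : p 0 = q 0) (h1 : p 1 = q 1)
    (h2 : p 2 = q 2) : p = q := by
  ext i
  fin_cases i <;> assumption

@[simp] lemma rotY_zero (p : EuclideanSpace ℝ (Fin 3)) : rotY 0 p = p :=
  euclideanSpace_ext_three (by simp) (by simp) (by simp)

lemma rotY_rotY (φ ψ : ℝ) (p : EuclideanSpace ℝ (Fin 3)) :
    rotY φ (rotY ψ p) = rotY (φ + ψ) p := by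
  refine euclideanSpace_ext_three ?_ rfl ?_ <;>
  · simp only [rotY_apply_zero, rotY_apply_two, cos_add, sin_add]
    ring

lemma rotY_add_int_mul_two_pi (φ : ℝ) (m : ℤ) (p : EuclideanSpace ℝ (Fin 3)) :
    rotY (φ + m * (2 * π)) p = rotY φ p := by
  refine euclideanSpace_ext_three ?_ rfl ?_ <;>
  simp [cos_add_int_mul_two_pi, sin_add_int_mul_two_pi]

lemma rotY_smul (φ t : ℝ) (p : EuclideanSpace ℝ (Fin 3)) : rotY φ (t • p) = t • rotY φ p := by
  refine euclideanSpace_ext_three ?_ rfl ?_ <;>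
  · simp only [rotY_apply_zero, rotY_apply_two, PiLp.smul_apply, smul_eq_mul]
    ring

lemma isometry_rotY (φ : ℝ) : Isometry (rotY φ) := by
  refine Isometry.of_dist_eq fun p q ↦ ?_
  rw [EuclideanSpace.dist_eq, EuclideanSpace.dist_eq, Fin.sum_univ_three, Fin.sum_univ_three]
  congr 1
  simp only [rotY_apply_zero, rotY_apply_one, rotY_apply_two, Real.dist_eq, sq_abs]
  linear_combination ((p 0 - q 0) ^ 2 + (p 2 - q 2) ^ 2) * sin_sq_add_cos_sq φ

lemma mem_rotY_image {φ : ℝ} {S : Set (EuclideanSpace ℝ (Fin 3))} {p : EuclideanSpace ℝ (Fin 3)} :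
    p ∈ rotY φ '' S ↔ rotY (-φ) p ∈ S := by
  constructor
  · rintro ⟨q, hq, rfl⟩
    simpa [rotY_rotY] using hq
  · intro h
    exact ⟨_, h, by simp [rotY_rotY]⟩

lemma isClosed_rotY_image {φ : ℝ} {S : Set (EuclideanSpace ℝ (Fin 3))} (hS : IsClosed S) :
    IsClosed (rotY φ '' S) := by
  have : rotY φ '' S = rotY (-φ) ⁻¹' S := Set.ext fun _ ↦ mem_rotY_image
  rw [this]
  exact hS.preimage (isometry_rotY _).continuous

/-! ### Wedges and the gauge of the spindle -/

/-- The wedge around the upper half of the `z`-axis, of angle `2π / n`, with edge the `y`-axis. -/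
def yWedge (n : ℕ) : Set (EuclideanSpace ℝ (Fin 3)) :=
  {p | |p 0| * cos (π / n) ≤ p 2 * sin (π / n)}

lemma pi_div_mem_Ioc {n : ℕ} (hn : 2 ≤ n) : 0 < π / n ∧ π / n ≤ π / 2 := by
  have : (2 : ℝ) ≤ n := by exact_mod_cast hn
  exact ⟨by positivity, by gcongr⟩

lemma sin_pi_div_pos {n : ℕ} (hn : 2 ≤ n) : 0 < sin (π / n) := by
  have := pi_div_mem_Ioc hn
  exact sin_pos_of_pos_of_lt_pi this.1 (by linarith [pi_pos])

lemma cos_pi_div_nonneg {n : ℕ} (hn : 2 ≤ n) : 0 ≤ cos (π / n) := by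
  have := pi_div_mem_Ioc hn
  exact cos_nonneg_of_mem_Icc ⟨by linarith, this.2⟩

/-- Reducing `j` modulo `n` changes the angle by a multiple of `π`, hence the cosine by a sign at
most, and leaves an angle in `[π / n, π - π / n]`. -/
lemma abs_cos_pi_mul_int_div_le {n : ℕ} (hn : 2 ≤ n) {j : ℤ} (hj : ¬ (n : ℤ) ∣ j) :
    |cos (π * j / n)| ≤ cos (π / n) := by
  have hn0 : (0 : ℝ) < n := by positivity
  have hnz : (0 : ℤ) < n := by positivity
  have hi0 : 1 ≤ j % n := by
    have h1 := Int.emod_nonneg j hnz.ne'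
    have h2 : j % n ≠ 0 := fun h ↦ hj (Int.dvd_of_emod_eq_zero h)
    omega
  have hi1 : j % n ≤ n - 1 := by
    have := Int.emod_lt_of_pos j hnz
    omega
  have hj' : (j : ℝ) = (j % n : ℤ) + n * (j / n : ℤ) := by exact_mod_cast (Int.emod_add_mul_ediv j n).symm
  have h0 : (1 : ℝ) ≤ (j % n : ℤ) := by exact_mod_cast hi0
  have h1 : ((j % n : ℤ) : ℝ) ≤ n - 1 := by exact_mod_cast hi1
  have harg : π * j / n = π * (j % n : ℤ) / n + (j / n : ℤ) * π := by
    rw [hj']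
    field_simp
  rw [harg, cos_add_int_mul_pi, abs_mul, abs_zpow, abs_neg, abs_one, one_zpow, one_mul]
  set i : ℝ := ((j % n : ℤ) : ℝ)
  have hlo : π / n ≤ π * i / n := by
    gcongr
    nlinarith [pi_pos]
  have hhi : π * i / n ≤ π - π / n := by
    rw [div_le_iff₀ hn0]
    have : (π - π / n) * n = π * (n - 1) := by
      field_simp
    rw [this]
    gcongr
  have hπ := pi_div_mem_Ioc hn
  rw [abs_le]
  constructor
  · rw [← cos_pi_sub]
    exact cos_le_cos_of_nonneg_of_le_pi (by linarith) (by linarith) hhi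
  · exact cos_le_cos_of_nonneg_of_le_pi hπ.1.le (by linarith) hlo

lemma apply_two_sub_rotY (γ : ℝ) (p : EuclideanSpace ℝ (Fin 3)) :
    p 2 - rotY (2 * γ) p 2 = 2 * (p 2 * sin γ ^ 2 + p 0 * (sin γ * cos γ)) := by
  rw [rotY_apply_two, sin_two_mul, cos_two_mul']
  linear_combination -p 2 * sin_sq_add_cos_sq γ

/-- A point of the wedge is the highest of its `n` rotated images. The explicit slack matters: a tie
in height forces the point onto the edge of the wedge, which later shows that distinct sheets
overlap in null sets. -/
lemma sq_mul_le_apply_two_sub_rotY {n : ℕ} (hn : 2 ≤ n) {p : EuclideanSpace ℝ (Fin 3)}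
    (hp : p ∈ yWedge n) {j : ℤ} (hj : ¬ (n : ℤ) ∣ j) :
    2 * sin (π / n) * (p 2 * sin (π / n) - |p 0| * cos (π / n)) ≤
      p 2 - rotY (2 * π * j / n) p 2 := by
  have hc := abs_cos_pi_mul_int_div_le hn hj
  have hs := sin_pi_div_pos hn
  have hc0 := cos_pi_div_nonneg hn
  have hp' : |p 0| * cos (π / n) ≤ p 2 * sin (π / n) := hp
  set γ := π * j / n with hγ
  have hsγ : sin (π / n) ≤ |sin γ| := by
    refine le_of_sq_le_sq ?_ (abs_nonneg _)
    have := sq_le_sq₀ (abs_nonneg _) hc0 |>.2 hc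
    rw [sq_abs] at this ⊢
    linarith [sin_sq_add_cos_sq γ, sin_sq_add_cos_sq (π / n)]
  have hp2 : 0 ≤ p 2 := by
    have : 0 ≤ p 2 * sin (π / n) := (by positivity : 0 ≤ |p 0| * cos (π / n)).trans hp'
    exact nonneg_of_mul_nonneg_left this hs
  rw [show 2 * π * j / n = 2 * γ by rw [hγ]; ring, apply_two_sub_rotY]
  have h1 : -(|p 0| * (|sin γ| * |cos γ|)) ≤ p 0 * (sin γ * cos γ) := by
    rw [← abs_mul, ← abs_mul]
    exact neg_abs_le _
  have h2 : p 2 * sin (π / n) - |p 0| * cos (π / n) ≤ p 2 * |sin γ| - |p 0| * |cos γ| := by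
    gcongr
  have h3 : sin (π / n) * (p 2 * sin (π / n) - |p 0| * cos (π / n)) ≤
      |sin γ| * (p 2 * |sin γ| - |p 0| * |cos γ|) :=
    mul_le_mul hsγ h2 (by linarith) (abs_nonneg _)
  rw [← sq_abs (sin γ)]
  nlinarith

lemma rotY_two_pi_mul_int {n : ℕ} (hn : n ≠ 0) {j : ℤ} (hj : (n : ℤ) ∣ j)
    (φ : ℝ) (p : EuclideanSpace ℝ (Fin 3)) : rotY (φ + 2 * π * j / n) p = rotY φ p := by
  obtain ⟨m, rfl⟩ := hj
  rw [← rotY_add_int_mul_two_pi φ m p]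
  congr 1
  push_cast
  field_simp

lemma rotY_apply_two_le {n : ℕ} (hn : 2 ≤ n) {p : EuclideanSpace ℝ (Fin 3)}
    (hp : p ∈ yWedge n) (j : ℤ) : rotY (2 * π * j / n) p 2 ≤ p 2 := by
  by_cases hj : (n : ℤ) ∣ j
  · have := rotY_two_pi_mul_int (by omega) hj 0 p
    rw [zero_add, rotY_zero] at this
    rw [this]
  · have := sq_mul_le_apply_two_sub_rotY hn hp hj
    have hp' : |p 0| * cos (π / n) ≤ p 2 * sin (π / n) := hp
    have hs := sin_pi_div_pos hn
    have : 0 ≤ 2 * sin (π / n) * (p 2 * sin (π / n) - |p 0| * cos (π / n)) :=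
      mul_nonneg (by positivity) (by linarith)
    linarith

/-- Comparison with the two neighbouring rotations suffices, one for each face of the wedge. -/
lemma mem_yWedge_of_rotY_le {n : ℕ} (hn : 2 ≤ n) {p : EuclideanSpace ℝ (Fin 3)}
    (h1 : rotY (2 * (π / n)) p 2 ≤ p 2) (h2 : rotY (2 * (-(π / n))) p 2 ≤ p 2) :
    p ∈ yWedge n := by
  have e1 := apply_two_sub_rotY (π / n) p
  have e2 := apply_two_sub_rotY (-(π / n)) p
  have hs := sin_pi_div_pos hn
  rw [sin_neg, cos_neg] at e2
  have g1 : 0 ≤ p 2 * sin (π / n) + p 0 * cos (π / n) := by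
    refine nonneg_of_mul_nonneg_right (?_ : 0 ≤ sin (π / n) * _) hs
    linarith
  have g2 : 0 ≤ p 2 * sin (π / n) - p 0 * cos (π / n) := by
    refine nonneg_of_mul_nonneg_right (?_ : 0 ≤ sin (π / n) * _) hs
    linarith
  change |p 0| * cos (π / n) ≤ _
  rcases abs_cases (p 0) with ⟨h, -⟩ | ⟨h, -⟩ <;> rw [h] <;> linarith

/-- The largest of the `z`-coordinates of the `n` images of `p` under the rotations about the
`y`-axis through multiples of `2π / n`. -/
noncomputable def spindleHeight (n : ℕ) [NeZero n] (p : EuclideanSpace ℝ (Fin 3)) : ℝ :=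
  Finset.univ.sup' Finset.univ_nonempty fun k : Fin n ↦ rotY (-(2 * π * (k : ℕ) / n)) p 2

lemma continuous_spindleHeight (n : ℕ) [NeZero n] : Continuous (spindleHeight n) := by
  refine Continuous.finset_sup'_apply _ fun k _ ↦ ?_
  have := (isometry_rotY (-(2 * π * (k : ℕ) / n))).continuous
  fun_prop

lemma exists_fin_rotY_eq (n : ℕ) [NeZero n] (j : ℤ) : ∃ k : Fin n, ∀ p,
    rotY (-(2 * π * j / n)) p = rotY (-(2 * π * (k : ℕ) / n)) p := by
  have hn : n ≠ 0 := NeZero.ne n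
  have hnz : (0 : ℤ) < n := by positivity
  have h0 := Int.emod_nonneg j hnz.ne'
  have h1 := Int.emod_lt_of_pos j hnz
  refine ⟨⟨(j % n).toNat, by omega⟩, fun p ↦ ?_⟩
  have hd : (n : ℤ) ∣ (j % n).toNat - j := by
    rw [Int.toNat_of_nonneg h0]
    exact Int.dvd_emod_sub_self
  rw [← rotY_two_pi_mul_int hn hd (-(2 * π * ((j % n).toNat : ℕ) / n)) p]
  congr 1
  push_cast
  ring

lemma spindleHeight_eq {n : ℕ} [NeZero n] (hn : 2 ≤ n) {p : EuclideanSpace ℝ (Fin 3)} {j : ℤ}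
    (hj : rotY (-(2 * π * j / n)) p ∈ yWedge n) :
    spindleHeight n p = rotY (-(2 * π * j / n)) p 2 := by
  refine le_antisymm (Finset.sup'_le _ _ fun k _ ↦ ?_) ?_
  · have := rotY_apply_two_le hn hj (j - (k : ℕ))
    rw [rotY_rotY] at this
    refine le_of_eq_of_le (congrArg (fun φ ↦ rotY φ p 2) ?_) this
    push_cast
    ring
  · obtain ⟨k, hk⟩ := exists_fin_rotY_eq n j
    rw [hk]
    exact Finset.le_sup' (fun k : Fin n ↦ rotY (-(2 * π * (k : ℕ) / n)) p 2) (Finset.mem_univ k)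

lemma exists_rotY_mem_yWedge {n : ℕ} [NeZero n] (hn : 2 ≤ n) (p : EuclideanSpace ℝ (Fin 3)) :
    ∃ k : Fin n, rotY (-(2 * π * (k : ℕ) / n)) p ∈ yWedge n := by
  obtain ⟨k, -, hk⟩ := Finset.exists_mem_eq_sup' (Finset.univ_nonempty (α := Fin n))
    fun k : Fin n ↦ rotY (-(2 * π * (k : ℕ) / n)) p 2
  have hmax : ∀ j : ℤ, rotY (-(2 * π * j / n)) p 2 ≤ rotY (-(2 * π * (k : ℕ) / n)) p 2 := by
    intro j
    obtain ⟨i, hi⟩ := exists_fin_rotY_eq n j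
    rw [hi, ← hk]
    exact Finset.le_sup' (fun k : Fin n ↦ rotY (-(2 * π * (k : ℕ) / n)) p 2) (Finset.mem_univ i)
  refine ⟨k, mem_yWedge_of_rotY_le hn ?_ ?_⟩
  · rw [rotY_rotY]
    refine le_of_eq_of_le (congrArg (fun φ ↦ rotY φ p 2) ?_) (hmax ((k : ℕ) - 1))
    push_cast
    ring
  · rw [rotY_rotY]
    refine le_of_eq_of_le (congrArg (fun φ ↦ rotY φ p 2) ?_) (hmax ((k : ℕ) + 1))
    push_cast
    ring

/-- The gauge of the solid cone of slope `α`, relative to the centre of its base. -/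
noncomputable def coneGauge (α : ℝ) (p : EuclideanSpace ℝ (Fin 3)) : ℝ :=
  p 2 * cos α + √(p 0 ^ 2 + p 1 ^ 2) * sin α

/-- The gauge of the spindle. -/
noncomputable def spindleGauge (n : ℕ) [NeZero n] (p : EuclideanSpace ℝ (Fin 3)) : ℝ :=
  spindleHeight n p * cos (π / (2 * n)) +
    √(p 0 ^ 2 + p 1 ^ 2 + p 2 ^ 2 - spindleHeight n p ^ 2) * sin (π / (2 * n))

lemma continuous_spindleGauge (n : ℕ) [NeZero n] : Continuous (spindleGauge n) := by
  have := continuous_spindleHeight n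
  unfold spindleGauge
  fun_prop

/-- Rotation preserves the norm, so once the height is known the square root is the distance of the
rotated point from the `z`-axis. -/
lemma spindleGauge_eq {n : ℕ} [NeZero n] (hn : 2 ≤ n) {p : EuclideanSpace ℝ (Fin 3)} {j : ℤ}
    (hj : rotY (-(2 * π * j / n)) p ∈ yWedge n) :
    spindleGauge n p = coneGauge (π / (2 * n)) (rotY (-(2 * π * j / n)) p) := by
  rw [spindleGauge, spindleHeight_eq hn hj, coneGauge]
  congr 3
  simp only [rotY_apply_zero, rotY_apply_one, rotY_apply_two]
  linear_combination -(p 0 ^ 2 + p 2 ^ 2) * sin_sq_add_cos_sq (-(2 * π * j / n))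

lemma cos_pi_div_two_mul_pos {n : ℕ} (hn : 2 ≤ n) : 0 < cos (π / (2 * n)) := by
  have h := pi_div_mem_Ioc hn
  have : π / (2 * n) = π / n / 2 := by ring
  rw [this]
  exact cos_pos_of_mem_Ioo ⟨by linarith, by linarith [pi_pos]⟩

lemma sin_pi_div_two_mul_pos {n : ℕ} (hn : 2 ≤ n) : 0 < sin (π / (2 * n)) := by
  have h := pi_div_mem_Ioc hn
  have : π / (2 * n) = π / n / 2 := by ring
  rw [this]
  exact sin_pos_of_pos_of_lt_pi (by linarith) (by linarith [pi_pos])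

lemma mem_conePiece_iff {n : ℕ} (hn : 2 ≤ n) {R : ℝ} {p : EuclideanSpace ℝ (Fin 3)} :
    p ∈ conePiece n R ↔ p ∈ yWedge n ∧ coneGauge (π / (2 * n)) p ≤ R * sin (π / (2 * n)) := by
  have hs := sin_pi_div_pos hn
  have hc := cos_pi_div_two_mul_pos hn
  have hc0 := cos_pi_div_nonneg hn
  have hw : |p 0| * tan (π / 2 - π / n) ≤ p 2 ↔ p ∈ yWedge n := by
    rw [tan_pi_div_two_sub, tan_eq_sin_div_cos, inv_div, ← mul_div_assoc, div_le_iff₀ hs]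
    rfl
  have hg : p 2 ≤ (R - √(p 0 ^ 2 + p 1 ^ 2)) * tan (π / (2 * n)) ↔
      coneGauge (π / (2 * n)) p ≤ R * sin (π / (2 * n)) := by
    rw [tan_eq_sin_div_cos, ← mul_div_assoc, le_div_iff₀ hc, coneGauge, sub_mul, le_sub_iff_add_le]
  change ((0 ≤ p 2 ∧ _) ∧ _) ↔ _
  rw [hw, hg]
  refine ⟨fun h ↦ ⟨h.2, h.1.2⟩, fun h ↦ ⟨⟨?_, h.2⟩, h.1⟩⟩
  have : |p 0| * cos (π / n) ≤ p 2 * sin (π / n) := h.1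
  exact nonneg_of_mul_nonneg_left ((by positivity : 0 ≤ |p 0| * cos (π / n)).trans this) hs

lemma mem_halfSheet_iff {n : ℕ} (hn : 2 ≤ n) {R : ℝ} {p : EuclideanSpace ℝ (Fin 3)} :
    p ∈ halfSheet R (π / (2 * n)) ↔
      coneGauge (π / (2 * n)) p = R * sin (π / (2 * n)) ∧ p ∈ yWedge n ∧ 0 ≤ p 1 := by
  have hc := cos_pi_div_two_mul_pos hn
  have hg : p 2 = (R - √(p 0 ^ 2 + p 1 ^ 2)) * tan (π / (2 * n)) ↔
      coneGauge (π / (2 * n)) p = R * sin (π / (2 * n)) := by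
    rw [tan_eq_sin_div_cos, ← mul_div_assoc, eq_div_iff hc.ne', coneGauge, sub_mul,
      eq_sub_iff_add_eq]
  rw [← hg, halfSheet, show 2 * (π / (2 * n)) = π / n by ring]
  rfl

lemma mem_spindle_iff {n : ℕ} [NeZero n] (hn : 2 ≤ n) {R : ℝ} {p : EuclideanSpace ℝ (Fin 3)} :
    p ∈ spindle n R ↔ spindleGauge n p ≤ R * sin (π / (2 * n)) := by
  simp only [spindle, Set.mem_iUnion, mem_rotY_image, mem_conePiece_iff hn]
  constructor
  · rintro ⟨k, hk, hg⟩
    rwa [spindleGauge_eq hn (j := (k : ℕ)) (by exact_mod_cast hk)]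
  · intro h
    obtain ⟨k, hk⟩ := exists_rotY_mem_yWedge hn p
    refine ⟨k, hk, ?_⟩
    rwa [spindleGauge_eq hn (j := (k : ℕ)) (by exact_mod_cast hk)] at h

lemma spindleGauge_smul {n : ℕ} [NeZero n] (hn : 2 ≤ n) {t : ℝ} (ht : 0 ≤ t)
    (p : EuclideanSpace ℝ (Fin 3)) : spindleGauge n (t • p) = t * spindleGauge n p := by
  obtain ⟨k, hk⟩ := exists_rotY_mem_yWedge hn p
  have hk' : rotY (-(2 * π * (k : ℕ) / n)) (t • p) ∈ yWedge n := by
    rw [rotY_smul]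
    set q := rotY (-(2 * π * (k : ℕ) / n)) p
    change |t * q 0| * cos (π / n) ≤ t * q 2 * sin (π / n)
    rw [abs_mul, abs_of_nonneg ht, mul_assoc, mul_assoc]
    exact mul_le_mul_of_nonneg_left hk ht
  rw [spindleGauge_eq hn (j := (k : ℕ)) (by exact_mod_cast hk'),
    spindleGauge_eq hn (j := (k : ℕ)) (by exact_mod_cast hk), rotY_smul]
  simp only [coneGauge, PiLp.smul_apply, smul_eq_mul, mul_pow, ← mul_add]
  rw [sqrt_mul (sq_nonneg t), sqrt_sq ht]
  ring

/-- In the plane `y = 0` the gauge is linear on each side of the `z`-axis, with normals at angles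
`±π / (2 * n)` to it. Rotation through `π / n` carries one normal to the other: this is the symmetry
of the regular `2n`-gon. -/
lemma rotY_mem_yWedge_of_nonneg {n : ℕ} {p : EuclideanSpace ℝ (Fin 3)}
    (hp : p ∈ yWedge n) (h0 : 0 ≤ p 0) (h1 : p 1 = 0) :
    rotY (-(π / n)) p ∈ yWedge n ∧
      coneGauge (π / (2 * n)) (rotY (-(π / n)) p) = coneGauge (π / (2 * n)) p := by
  have hp' : |p 0| * cos (π / n) ≤ p 2 * sin (π / n) := hp
  rw [abs_of_nonneg h0] at hp'
  have hle : rotY (-(π / n)) p 0 ≤ 0 := by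
    rw [rotY_apply_zero, cos_neg, sin_neg]
    linarith
  constructor
  · change |rotY (-(π / n)) p 0| * _ ≤ _
    rw [abs_of_nonpos hle, rotY_apply_zero, rotY_apply_two, cos_neg, sin_neg]
    nlinarith [sq_nonneg (sin (π / n)), sq_nonneg (cos (π / n)),
      mul_nonneg h0 (sq_nonneg (sin (π / n))), mul_nonneg h0 (sq_nonneg (cos (π / n)))]
  · rw [coneGauge, coneGauge, rotY_apply_one, h1, zero_pow two_ne_zero, add_zero, add_zero,
      sqrt_sq_eq_abs, sqrt_sq_eq_abs, abs_of_nonneg h0, abs_of_nonpos hle, rotY_apply_zero,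
      rotY_apply_two, cos_neg, sin_neg]
    have e1 : cos (π / n) * cos (π / (2 * n)) + sin (π / n) * sin (π / (2 * n)) =
        cos (π / (2 * n)) := by
      rw [← cos_sub]
      congr 1
      ring
    have e2 : sin (π / n) * cos (π / (2 * n)) - cos (π / n) * sin (π / (2 * n)) =
        sin (π / (2 * n)) := by
      rw [← sin_sub]
      congr 1
      ring
    linear_combination p 2 * e1 + p 0 * e2

lemma rotY_mem_yWedge_of_nonpos {n : ℕ} {p : EuclideanSpace ℝ (Fin 3)}
    (hp : p ∈ yWedge n) (h0 : p 0 ≤ 0) (h1 : p 1 = 0) :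
    rotY (π / n) p ∈ yWedge n ∧
      coneGauge (π / (2 * n)) (rotY (π / n) p) = coneGauge (π / (2 * n)) p := by
  -- Reflection in `x = 0` reduces this to the nonnegative case.
  let q : EuclideanSpace ℝ (Fin 3) := !₂[-p 0, p 1, p 2]
  have hq0 : q 0 = -p 0 := rfl
  have hq1 : q 1 = p 1 := rfl
  have hq2 : q 2 = p 2 := rfl
  have hq : q ∈ yWedge n := by
    change |q 0| * _ ≤ q 2 * _
    rw [hq0, hq2, abs_neg]
    exact hp
  obtain ⟨ha, hb⟩ := rotY_mem_yWedge_of_nonneg hq (by rw [hq0]; linarith) h1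
  have e0 : rotY (-(π / n)) q 0 = -rotY (π / n) p 0 := by
    simp [hq0, hq2]
    ring
  have e2 : rotY (-(π / n)) q 2 = rotY (π / n) p 2 := by simp [hq0, hq2]
  constructor
  · change |rotY (-(π / n)) q 0| * cos (π / n) ≤ rotY (-(π / n)) q 2 * sin (π / n) at ha
    rwa [e0, e2, abs_neg] at ha
  · simp only [coneGauge, e0, e2, hq0, hq1, hq2, rotY_apply_one, neg_sq] at hb ⊢
    exact hb

lemma spindleGauge_rotY {n : ℕ} [NeZero n] (hn : 2 ≤ n) {p : EuclideanSpace ℝ (Fin 3)}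
    (h1 : p 1 = 0) : spindleGauge n (rotY (-(π / n)) p) = spindleGauge n p := by
  obtain ⟨k, hk⟩ := exists_rotY_mem_yWedge hn p
  have hk' : rotY (-(2 * π * ((k : ℕ) : ℤ) / n)) p ∈ yWedge n := by exact_mod_cast hk
  rw [spindleGauge_eq hn hk']
  rcases le_total 0 (rotY (-(2 * π * ((k : ℕ) : ℤ) / n)) p 0) with h0 | h0
  · obtain ⟨ha, hb⟩ := rotY_mem_yWedge_of_nonneg hk' h0 h1
    rw [rotY_rotY, add_comm, ← rotY_rotY] at ha hb
    rw [spindleGauge_eq hn ha, hb]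
  · obtain ⟨ha, hb⟩ := rotY_mem_yWedge_of_nonpos hk' h0 h1
    have e : rotY (π / n) (rotY (-(2 * π * ((k : ℕ) : ℤ) / n)) p) =
        rotY (-(2 * π * ((k : ℕ) - 1 : ℤ) / n)) (rotY (-(π / n)) p) := by
      rw [rotY_rotY, rotY_rotY]
      congr 1
      push_cast
      ring
    rw [e] at ha hb
    rw [spindleGauge_eq hn ha, hb]

/-! ### The gauge of the `n`-con and its boundary -/

/-- The gauge of the `n`-con. -/
noncomputable def polyconGauge (n : ℕ) [NeZero n] (p : EuclideanSpace ℝ (Fin 3)) : ℝ :=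
  if 0 ≤ p 1 then spindleGauge n p else spindleGauge n (rotY (-(π / n)) p)

lemma polyconGauge_of_nonneg {n : ℕ} [NeZero n] {p : EuclideanSpace ℝ (Fin 3)} (h : 0 ≤ p 1) :
    polyconGauge n p = spindleGauge n p := if_pos h

lemma polyconGauge_of_nonpos {n : ℕ} [NeZero n] (hn : 2 ≤ n) {p : EuclideanSpace ℝ (Fin 3)}
    (h : p 1 ≤ 0) : polyconGauge n p = spindleGauge n (rotY (-(π / n)) p) := by
  rcases h.lt_or_eq with h | h
  · exact if_neg h.not_ge
  · rw [polyconGauge_of_nonneg h.ge, spindleGauge_rotY hn h]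

lemma continuous_polyconGauge {n : ℕ} [NeZero n] (hn : 2 ≤ n) : Continuous (polyconGauge n) := by
  refine Continuous.if_le (continuous_spindleGauge n)
    ((continuous_spindleGauge n).comp (isometry_rotY _).continuous) continuous_const
    (by fun_prop) fun p hp ↦ (spindleGauge_rotY hn hp.symm).symm

lemma polyconGauge_smul {n : ℕ} [NeZero n] (hn : 2 ≤ n) {t : ℝ} (ht : 0 ≤ t)
    (p : EuclideanSpace ℝ (Fin 3)) : polyconGauge n (t • p) = t * polyconGauge n p := by
  rcases le_total 0 (p 1) with h | h
  · rw [polyconGauge_of_nonneg h, polyconGauge_of_nonneg (mul_nonneg ht h),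
      spindleGauge_smul hn ht]
  · rw [polyconGauge_of_nonpos hn h,
      polyconGauge_of_nonpos hn (mul_nonpos_of_nonneg_of_nonpos ht h), rotY_smul,
      spindleGauge_smul hn ht]

lemma polycon_eq {n : ℕ} [NeZero n] (hn : 2 ≤ n) (R : ℝ) :
    polycon n R = {p | polyconGauge n p ≤ R * sin (π / (2 * n))} := by
  ext p
  rw [polycon, Set.mem_union, mem_rotY_image]
  change (p ∈ spindle n R ∧ 0 ≤ p 1) ∨ (rotY (-(π / n)) p ∈ spindle n R ∧ p 1 ≤ 0) ↔
    polyconGauge n p ≤ R * sin (π / (2 * n))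
  rw [mem_spindle_iff hn, mem_spindle_iff hn]
  constructor
  · rintro (⟨h, h1⟩ | ⟨h, h1⟩)
    · rwa [polyconGauge_of_nonneg h1]
    · rwa [polyconGauge_of_nonpos hn h1]
  · intro h
    rcases le_total 0 (p 1) with h1 | h1
    · exact Or.inl ⟨polyconGauge_of_nonneg (n := n) h1 ▸ h, h1⟩
    · exact Or.inr ⟨polyconGauge_of_nonpos hn h1 ▸ h, h1⟩

/-- A point `x` at level `c` is not interior, since `t • x` with `t > 1` close to 1 has level `t * c
> c`. -/
lemma frontier_setOf_le_of_homogeneous {E : Type*} [NormedAddCommGroup E] [NormedSpace ℝ E]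
    {f : E → ℝ} (hf : Continuous f) (hs : ∀ t : ℝ, 0 ≤ t → ∀ x, f (t • x) = t * f x) {c : ℝ}
    (hc : 0 < c) : frontier {x | f x ≤ c} = {x | f x = c} := by
  refine (frontier_le_subset_eq hf continuous_const).antisymm fun x hx ↦ ?_
  have hx' : f x = c := hx
  refine ⟨subset_closure hx'.le, fun hint ↦ ?_⟩
  rw [mem_interior_iff_mem_nhds] at hint
  have ht : Filter.Tendsto (fun t : ℝ ↦ t • x) (nhdsWithin 1 (Set.Ioi 1)) (nhds x) := by
    have : Continuous fun t : ℝ ↦ t • x := by fun_prop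
    simpa using (this.tendsto 1).mono_left nhdsWithin_le_nhds
  obtain ⟨t, htx, ht1⟩ := ((ht.eventually hint).and self_mem_nhdsWithin).exists
  have ht1' : 1 < t := ht1
  have h2 : f (t • x) ≤ c := htx
  rw [hs t (by linarith), hx'] at h2
  nlinarith

/-- The half of the boundary of the spindle on which `0 ≤ y`. -/
def spindleHalfBoundary (n : ℕ) (R : ℝ) : Set (EuclideanSpace ℝ (Fin 3)) :=
  ⋃ k : Fin n, rotY (2 * π * (k : ℕ) / n) '' halfSheet R (π / (2 * n))

lemma mem_spindleHalfBoundary_iff {n : ℕ} [NeZero n] (hn : 2 ≤ n) {R : ℝ}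
    {p : EuclideanSpace ℝ (Fin 3)} : p ∈ spindleHalfBoundary n R ↔
      spindleGauge n p = R * sin (π / (2 * n)) ∧ 0 ≤ p 1 := by
  simp only [spindleHalfBoundary, Set.mem_iUnion, mem_rotY_image, mem_halfSheet_iff hn,
    rotY_apply_one]
  constructor
  · rintro ⟨k, hg, hk, h1⟩
    refine ⟨?_, h1⟩
    rwa [spindleGauge_eq hn (j := (k : ℕ)) (by exact_mod_cast hk)]
  · rintro ⟨h, h1⟩
    obtain ⟨k, hk⟩ := exists_rotY_mem_yWedge hn p
    refine ⟨k, ?_, hk, h1⟩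
    rwa [spindleGauge_eq hn (j := (k : ℕ)) (by exact_mod_cast hk)] at h

/-- The reflection in the plane `y = 0`. -/
noncomputable def reflY (p : EuclideanSpace ℝ (Fin 3)) : EuclideanSpace ℝ (Fin 3) :=
  !₂[p 0, -p 1, p 2]

lemma isometry_reflY : Isometry reflY := by
  refine Isometry.of_dist_eq fun p q ↦ ?_
  rw [EuclideanSpace.dist_eq, EuclideanSpace.dist_eq, Fin.sum_univ_three, Fin.sum_univ_three]
  simp only [Real.dist_eq, sq_abs]
  congr 1
  change (p 0 - q 0) ^ 2 + (-p 1 - -q 1) ^ 2 + (p 2 - q 2) ^ 2 = _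
  ring

lemma reflY_reflY (p : EuclideanSpace ℝ (Fin 3)) : reflY (reflY p) = p :=
  euclideanSpace_ext_three rfl (neg_neg _) rfl

lemma spindleGauge_reflY (n : ℕ) [NeZero n] (p : EuclideanSpace ℝ (Fin 3)) :
    spindleGauge n (reflY p) = spindleGauge n p := by
  have h : spindleHeight n (reflY p) = spindleHeight n p := rfl
  rw [spindleGauge, h, spindleGauge]
  change _ + √(p 0 ^ 2 + (-p 1) ^ 2 + p 2 ^ 2 - _) * _ = _
  rw [neg_sq]

lemma frontier_polycon {n : ℕ} (hn : 2 ≤ n) {R : ℝ} (hR : 0 < R) :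
    frontier (polycon n R) = spindleHalfBoundary n R ∪
      rotY (π / n) '' (reflY '' spindleHalfBoundary n R) := by
  have : NeZero n := ⟨by omega⟩
  rw [polycon_eq hn, frontier_setOf_le_of_homogeneous (continuous_polyconGauge hn)
    (fun t ht p ↦ polyconGauge_smul hn ht p) (mul_pos hR (sin_pi_div_two_mul_pos hn))]
  ext p
  have hrefl : ∀ q, q ∈ reflY '' spindleHalfBoundary n R ↔
      spindleGauge n q = R * sin (π / (2 * n)) ∧ q 1 ≤ 0 := fun q ↦ by
    have : q ∈ reflY '' spindleHalfBoundary n R ↔ reflY q ∈ spindleHalfBoundary n R :=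
      ⟨fun ⟨x, hx, h⟩ ↦ by rwa [← h, reflY_reflY], fun h ↦ ⟨_, h, reflY_reflY q⟩⟩
    rw [this, mem_spindleHalfBoundary_iff hn, spindleGauge_reflY]
    exact and_congr_right fun _ ↦ neg_nonneg
  rw [Set.mem_union, mem_rotY_image, hrefl, mem_spindleHalfBoundary_iff hn, rotY_apply_one]
  change _ = _ ↔ _
  constructor
  · intro h
    rcases le_total 0 (p 1) with h1 | h1
    · exact Or.inl ⟨polyconGauge_of_nonneg (n := n) h1 ▸ h, h1⟩
    · exact Or.inr ⟨polyconGauge_of_nonpos hn h1 ▸ h, h1⟩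
  · rintro (⟨h, h1⟩ | ⟨h, h1⟩)
    · rwa [polyconGauge_of_nonneg h1]
    · rwa [polyconGauge_of_nonpos hn h1]

/-! ### Adding up the areas of the half sheets -/

lemma projEccentricity_mul {n : ℕ} (hn : 2 ≤ n) :
    projEccentricity n * (sin (π / (2 * n)) * sin (2 * (π / (2 * n)))) =
      cos (π / (2 * n)) * cos (2 * (π / (2 * n))) := by
  have h1 := (sin_pi_div_pos hn).ne'
  have h2 := (sin_pi_div_two_mul_pos hn).ne'
  rw [show 2 * (π / (2 * n)) = π / n by ring, projEccentricity, cot_eq_cos_div_sin,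
    cot_eq_cos_div_sin]
  generalize sin (π / n) = a at *
  generalize sin (π / (2 * n)) = b at *
  field_simp

lemma projEccentricity_nonneg {n : ℕ} (hn : 2 ≤ n) : 0 ≤ projEccentricity n := by
  have h1 := sin_pi_div_pos hn
  have h2 := sin_pi_div_two_mul_pos hn
  have h3 := cos_pi_div_nonneg hn
  have h4 := cos_pi_div_two_mul_pos hn
  rw [projEccentricity, cot_eq_cos_div_sin, cot_eq_cos_div_sin]
  positivity

lemma tan_mul_sin_pos {n : ℕ} (hn : 2 ≤ n) :
    0 < tan (π / (2 * n)) * sin (2 * (π / (2 * n))) := by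
  have h1 := sin_pi_div_pos hn
  have h2 := sin_pi_div_two_mul_pos hn
  have h4 := cos_pi_div_two_mul_pos hn
  rw [show 2 * (π / (2 * n)) = π / n by ring, tan_eq_sin_div_cos]
  positivity

lemma isClosed_spindleHalfBoundary (n : ℕ) (R : ℝ) : IsClosed (spindleHalfBoundary n R) :=
  isClosed_iUnion_of_finite fun _ ↦ isClosed_rotY_image (isClosed_halfSheet _ _)

/-- A point common to two sheets has the same maximal height in both wedges, so the slack in
`sq_mul_le_apply_two_sub_rotY` vanishes and the point lies on a null edge. -/
lemma area_spindleHalfBoundary {n : ℕ} (hn : 2 ≤ n) (R : ℝ) :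
    μHE[2] (spindleHalfBoundary n R) = n * μHE[2] (halfSheet R (π / (2 * n))) := by
  have : NeZero n := ⟨by omega⟩
  rw [spindleHalfBoundary, measure_iUnion₀]
  · simp [(isometry_rotY _).euclideanHausdorffMeasure_image]
  · intro j k hjk
    have hnull := area_halfSheet_inter_edge_eq_zero (R := R) (cos_pi_div_two_mul_pos hn)
      (tan_mul_sin_pos hn) (projEccentricity_nonneg hn) (projEccentricity_mul hn)
    rw [← (isometry_rotY (2 * π * (j : ℕ) / n)).euclideanHausdorffMeasure_image] at hnull
    refine measure_mono_null ?_ hnull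
    rintro p ⟨hpj, hpk⟩
    rw [mem_rotY_image] at hpj hpk ⊢
    refine ⟨hpj, ?_⟩
    have hj := ((mem_halfSheet_iff hn).1 hpj).2.1
    have hk := ((mem_halfSheet_iff hn).1 hpk).2.1
    have hd : ¬ (n : ℤ) ∣ (j : ℕ) - (k : ℕ) := fun hd ↦ by
      have h0 := Int.eq_zero_of_abs_lt_dvd hd (by rw [abs_lt]; omega)
      exact hjk (Fin.ext (by omega))
    have h1 := sq_mul_le_apply_two_sub_rotY hn hj hd
    have e1 := spindleHeight_eq hn (p := p) (j := (j : ℕ)) (by exact_mod_cast hj)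
    have e2 := spindleHeight_eq hn (p := p) (j := (k : ℕ)) (by exact_mod_cast hk)
    have e3 : rotY (2 * π * ((j : ℕ) - (k : ℕ) : ℤ) / n) (rotY (-(2 * π * (j : ℕ) / n)) p) =
        rotY (-(2 * π * ((k : ℕ) : ℤ) / n)) p := by
      rw [rotY_rotY]
      congr 1
      push_cast
      ring
    rw [e3, ← e2, e1, Int.cast_natCast, sub_self] at h1
    have hs := sin_pi_div_pos hn
    have h2 := nonpos_of_mul_nonpos_right h1 (by positivity)
    change _ * sin (2 * (π / (2 * n))) ≤ _ * cos (2 * (π / (2 * n)))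
    rw [show 2 * (π / (2 * n)) = π / n by ring]
    linarith
  · exact fun k ↦ (isClosed_rotY_image (isClosed_halfSheet _ _)).measurableSet.nullMeasurableSet

lemma surfaceArea_polycon_eq_mul {n : ℕ} (hn : 2 ≤ n) {R : ℝ} (hR : 0 < R) :
    surfaceArea (polycon n R) = 2 * n * μHE[2] (halfSheet R (π / (2 * n))) := by
  have hclosed : IsClosed (rotY (π / n) '' (reflY '' spindleHalfBoundary n R)) := by
    refine isClosed_rotY_image ?_
    have : reflY '' spindleHalfBoundary n R = reflY ⁻¹' spindleHalfBoundary n R :=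
      congrFun (Set.image_eq_preimage_of_inverse reflY_reflY reflY_reflY) _
    rw [this]
    exact (isClosed_spindleHalfBoundary n R).preimage isometry_reflY.continuous
  rw [surfaceArea, frontier_polycon hn hR,
    measure_union₀ hclosed.measurableSet.nullMeasurableSet,
    (isometry_rotY _).euclideanHausdorffMeasure_image,
    isometry_reflY.euclideanHausdorffMeasure_image, area_spindleHalfBoundary hn]
  · ring
  · have hsub : spindleHalfBoundary n R ∩ rotY (π / n) '' (reflY '' spindleHalfBoundary n R) ⊆
        ⋃ k : Fin n, rotY (2 * π * (k : ℕ) / n) ''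
          (halfSheet R (π / (2 * n)) ∩ {p | p 1 = 0}) := by
      rintro p ⟨hp, hp'⟩
      obtain ⟨_, ⟨q, hq, rfl⟩, rfl⟩ := hp'
      obtain ⟨j, x, hx, rfl⟩ := Set.mem_iUnion.1 hq
      obtain ⟨k, hk⟩ := Set.mem_iUnion.1 hp
      refine Set.mem_iUnion.2 ⟨k, ?_⟩
      rw [mem_rotY_image] at hk ⊢
      have h1 : 0 ≤ -x 1 := hk.2.2
      have h2 : 0 ≤ x 1 := hx.2.2
      refine ⟨hk, ?_⟩
      change -x 1 = 0
      linarith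
    refine measure_mono_null hsub (measure_iUnion_null fun k ↦ ?_)
    rw [(isometry_rotY _).euclideanHausdorffMeasure_image]
    exact area_halfSheet_inter_y_eq_zero (cos_pi_div_two_mul_pos hn) (tan_mul_sin_pos hn)
      (projEccentricity_mul hn)

theorem surfaceArea_polycon {n : ℕ} (hn : 2 ≤ n) {R : ℝ} (hR : 0 < R) :
    surfaceArea (polycon n R) =
      ENNReal.ofReal (n * R ^ 2 / cos (π / (2 * n)) * polyconIntegral n) := by
  have hc := cos_pi_div_two_mul_pos hn
  rw [surfaceArea_polycon_eq_mul hn hR, area_halfSheet hR hc (tan_mul_sin_pos hn)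
    (projEccentricity_nonneg hn) (projEccentricity_mul hn), polyconIntegral]
  have h2n : (2 * n : ENNReal) = ENNReal.ofReal (2 * n) := by
    rw [ENNReal.ofReal_mul two_pos.le, ENNReal.ofReal_natCast, ENNReal.ofReal_ofNat]
  rw [h2n, ← ENNReal.ofReal_mul (by positivity)]
  congr 1
  field_simp

/-! ### Evaluation of `I_n` -/

lemma projEccentricity_eq {n : ℕ} (hn : 2 ≤ n) :
    projEccentricity n = cos (π / n) / (1 - cos (π / n)) := by
  have h2 := (sin_pi_div_two_mul_pos hn).ne'
  have h3 := (cos_pi_div_two_mul_pos hn).ne'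
  have e : π / n = 2 * (π / (2 * n)) := by ring
  have e1 : 1 - cos (π / n) = 2 * sin (π / (2 * n)) ^ 2 := by
    rw [e, cos_two_mul']
    linear_combination -sin_sq_add_cos_sq (π / (2 * n))
  have e2 : sin (π / n) = 2 * sin (π / (2 * n)) * cos (π / (2 * n)) := by rw [e, sin_two_mul]
  rw [projEccentricity, cot_eq_cos_div_sin, cot_eq_cos_div_sin, e1, e2]
  generalize cos (π / (2 * n)) = a at *
  generalize sin (π / (2 * n)) = b at *
  field_simp

lemma cosProd_eq (n : ℕ) : cosProd n = (2 * cos (π / n) - 1) / 4 := by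
  have e : π / n = 2 * (π / (2 * n)) := by ring
  have h3 : √(3 : ℝ) ^ 2 = 3 := sq_sqrt (by norm_num)
  rw [cosProd, cos_sub, cos_add, cos_pi_div_three, sin_pi_div_three, e, cos_two_mul']
  linear_combination (-sin (π / (2 * n)) ^ 2 / 4) * h3 -
    sin_sq_add_cos_sq (π / (2 * n)) / 4

lemma polyconIntegral_two : polyconIntegral 2 = π := by
  have h := projEccentricity_eq (le_refl 2)
  rw [Nat.cast_ofNat, cos_pi_div_two, zero_div] at h
  rw [polyconIntegral, h]
  simp

lemma polyconIntegral_three : polyconIntegral 3 = 4 / 3 := by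
  have h := projEccentricity_eq (n := 3) (by norm_num)
  rw [Nat.cast_ofNat, cos_pi_div_three] at h
  have h1 : projEccentricity 3 = 1 := by rw [h]; norm_num
  have hpos : ∀ θ ∈ Set.uIcc (-(π / 2)) (π / 2), 0 < 1 + cos θ := fun θ hθ ↦ by
    rw [Set.uIcc_of_le (by linarith [pi_pos])] at hθ
    linarith [cos_nonneg_of_mem_Icc hθ]
  rw [polyconIntegral, h1, intervalIntegral.integral_eq_sub_of_hasDerivAt
    -- With `t = tan (θ / 2)` this is `t / 2 + t ^ 3 / 6`, the antiderivative of `(1 + t ^ 2) / 2`.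
    (f := fun θ ↦ sin θ * (2 + cos θ) / (3 * (1 + cos θ) ^ 2))]
  · norm_num
  · intro θ hθ
    have hp := (hpos θ hθ).ne'
    have hd := ((hasDerivAt_sin θ).mul ((hasDerivAt_cos θ).const_add 2)).div
      ((((hasDerivAt_cos θ).const_add 1).pow 2).const_mul 3)
      (mul_ne_zero three_ne_zero (pow_ne_zero 2 hp))
    convert! hd using 1
    simp only [Pi.mul_apply, Pi.pow_apply]
    have hs : sin θ ^ 2 = 1 - cos θ ^ 2 := by linarith [sin_sq_add_cos_sq θ]
    field_simp
    push_cast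
    linear_combination -(1 + cos θ) * (3 + cos θ) * hs
  · refine ContinuousOn.intervalIntegrable ?_
    refine continuousOn_const.div (by fun_prop) fun θ hθ ↦ ?_
    rw [one_mul]
    exact (pow_pos (hpos θ hθ) 2).ne'

lemma integral_one_div_one_add_mul_cos_sq {c k : ℝ} (hk : 0 < k) (hk1 : k < 1)
    (hc : 2 * c - 1 = k ^ 2) :
    ∫ θ in (-(π / 2))..(π / 2), 1 / (1 + c / (1 - c) * cos θ) ^ 2 =
      2 * c * (1 - c) / k ^ 2 - 2 * (1 - c) ^ 3 / k ^ 3 * log ((1 + k) / (1 - k)) := by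
  have hc1 : 0 < 1 - c := by nlinarith
  have hc0 : 0 < c := by nlinarith
  have hcos : ∀ θ ∈ Set.uIcc (-(π / 2)) (π / 2), 0 ≤ cos θ := fun θ hθ ↦ by
    rw [Set.uIcc_of_le (by linarith [pi_pos])] at hθ
    exact cos_nonneg_of_mem_Icc hθ
  have hD : ∀ θ ∈ Set.uIcc (-(π / 2)) (π / 2), 0 < 1 - c + c * cos θ := fun θ hθ ↦ by
    have := hcos θ hθ
    positivity
  -- With `D = 1 - c + c * cos θ`, the derivative of `c / k ^ 2 * (sin θ / D)` is `1 / D ^ 2 + (1 -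
  -- c) / (k ^ 2 * D)`. The logarithms, whose difference is `log ((1 + k * t) / (1 - k * t))` for `t
  -- = tan (θ / 2)`, have derivative `k / D` and cancel the second term.
  rw [intervalIntegral.integral_eq_sub_of_hasDerivAt (f := fun θ ↦
    (1 - c) ^ 2 * (c / k ^ 2 * (sin θ / (1 - c + c * cos θ)) - (1 - c) / k ^ 3 *
      (log (1 + cos θ + k * sin θ) - log (1 + cos θ - k * sin θ))))]
  · simp only [sin_neg, cos_neg, sin_pi_div_two, cos_pi_div_two, add_zero, mul_zero, mul_one,
      mul_neg, sub_neg_eq_add, ← sub_eq_add_neg]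
    rw [log_div (by linarith) (by linarith)]
    field_simp
    ring
  · intro θ hθ
    have hC := hcos θ hθ
    have hDp := hD θ hθ
    have hs1 := sin_le_one θ
    have hs2 := neg_one_le_sin θ
    have hp : 0 < 1 + cos θ + k * sin θ := by nlinarith
    have hm : 0 < 1 + cos θ - k * sin θ := by nlinarith
    have hd1 := (hasDerivAt_sin θ).div (((hasDerivAt_cos θ).const_mul c).const_add (1 - c)) hDp.ne'
    have hd2 := (((hasDerivAt_cos θ).const_add 1).add ((hasDerivAt_sin θ).const_mul k)).log hp.ne'
    have hd3 := (((hasDerivAt_cos θ).const_add 1).sub ((hasDerivAt_sin θ).const_mul k)).log hm.ne'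
    have hd := ((hd1.const_mul (c / k ^ 2)).sub
      ((hd2.sub hd3).const_mul ((1 - c) / k ^ 3))).const_mul ((1 - c) ^ 2)
    convert! hd using 1
    have hs : sin θ ^ 2 = 1 - cos θ ^ 2 := by linarith [sin_sq_add_cos_sq θ]
    have hlog : (-sin θ + k * cos θ) / (1 + cos θ + k * sin θ) -
        (-sin θ - k * cos θ) / (1 + cos θ - k * sin θ) = k / (1 - c + c * cos θ) := by
      rw [div_sub_div _ _ hp.ne' hm.ne', div_eq_div_iff (by positivity) hDp.ne']
      have hcc : c = (1 + k ^ 2) / 2 := by linarith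
      rw [hcc]
      linear_combination (k * ((1 - k ^ 2) + (1 + k ^ 2) * cos θ) + k ^ 3) * hs
    simp only [Pi.add_apply, Pi.sub_apply]
    rw [hlog]
    have hl : 1 + c / (1 - c) * cos θ = (1 - c + c * cos θ) / (1 - c) := by field_simp
    rw [hl]
    set D := 1 - c + c * cos θ with hDdef
    field_simp
    linear_combination -c * c * hs - hc
  · refine ContinuousOn.intervalIntegrable ?_
    refine continuousOn_const.div (by fun_prop) fun θ hθ ↦ ?_
    have := hcos θ hθ
    positivity

lemma polyconIntegral_of_three_lt {n : ℕ} (hn : 3 < n) :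
    polyconIntegral n =
      (1 - cos (π / n)) / cosProd n *
        (cos (π / n) / 2 -
          (1 - cos (π / n)) ^ 2 / (4 * √(cosProd n)) *
            log ((1 + 2 * √(cosProd n)) / (1 - 2 * √(cosProd n)))) := by
  have hn' : (3 : ℝ) < n := by exact_mod_cast hn
  have hlt : π / n < π / 3 := by
    have := pi_pos
    gcongr
  have hpos : 0 < π / n := (pi_div_mem_Ioc (by omega)).1
  have hc1 : 1 / 2 < cos (π / n) := by
    rw [← cos_pi_div_three]
    exact cos_lt_cos_of_nonneg_of_le_pi hpos.le (by linarith [pi_pos]) hlt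
  have hc2 : cos (π / n) < 1 := by
    rw [← cos_zero]
    exact cos_lt_cos_of_nonneg_of_le_pi le_rfl (by linarith [pi_pos]) hpos
  have hq : 0 < cosProd n := by rw [cosProd_eq]; linarith
  have hsq : √(cosProd n) ^ 2 = cosProd n := sq_sqrt hq.le
  have hs : 0 < √(cosProd n) := sqrt_pos.2 hq
  have hk : 2 * cos (π / n) - 1 = (2 * √(cosProd n)) ^ 2 := by
    rw [mul_pow, hsq, cosProd_eq]
    ring
  rw [polyconIntegral, projEccentricity_eq (by omega),
    integral_one_div_one_add_mul_cos_sq (by positivity) (by nlinarith) hk]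
  -- The fifth occurrence is the one in the prefactor, outside any square root; rewriting it leaves
  -- everything in terms of `√(cosProd n)`.
  nth_rewrite 5 [← hsq]
  field_simp
  ring

theorem mainTheorem4 (R : ℝ) (hR : 0 < R) :
    (∀ n : ℕ, 2 ≤ n →
      surfaceArea (polycon n R) =
        ENNReal.ofReal (n * R ^ 2 / cos (π / (2 * n)) * polyconIntegral n)) ∧
    polyconIntegral 2 = π ∧
    polyconIntegral 3 = 4 / 3 ∧
    (∀ n : ℕ, 3 < n →
      polyconIntegral n =
        (1 - cos (π / n)) / cosProd n *
          (cos (π / n) / 2 -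
            (1 - cos (π / n)) ^ 2 / (4 * √(cosProd n)) *
              log ((1 + 2 * √(cosProd n)) / (1 - 2 * √(cosProd n))))) ∧
    surfaceArea (polycon 2 R) = ENNReal.ofReal (2 * √2 * π * R ^ 2) ∧
    surfaceArea (polycon 3 R) = ENNReal.ofReal (8 * R ^ 2 / √3) := by
  refine ⟨fun n hn ↦ surfaceArea_polycon hn hR, polyconIntegral_two, polyconIntegral_three,
    fun n hn ↦ polyconIntegral_of_three_lt hn, ?_, ?_⟩
  · rw [surfaceArea_polycon le_rfl hR, polyconIntegral_two]
    congr 1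
    have : π / (2 * (2 : ℕ)) = π / 4 := by norm_num
    rw [this, cos_pi_div_four]
    have h2 : √(2 : ℝ) ^ 2 = 2 := sq_sqrt (by norm_num)
    push_cast
    field_simp
    linear_combination -h2
  · rw [surfaceArea_polycon (by norm_num) hR, polyconIntegral_three]
    congr 1
    have : π / (2 * (3 : ℕ)) = π / 6 := by norm_num
    rw [this, cos_pi_div_six]
    push_cast
    field_simp
    norm_num
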